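/- Let $\mathfrak{o}$ be a complete discrete valuation ring with maximal ideal $\mathfrak{p}$ and finite residue field, let $\ell\in\mathbb{N}$ and $\mathfrak{o}_\ell=\mathfrak{o}/\mathfrak{p}^\ell$. Let $R$ be a finite, not necessarily commutative, $\mathfrak{o}_\ell$-algebra, let $M_1,\dots,M_k$ be finite indecomposable left $R$-modules, and let $\mathcal{C}=\langle M_1,\dots,M_k\rangle$ be the full subcategory of the category of left $R$-modules whose objects are the modules isomorphic to $\bigoplus_{i=1}^k M_i^{a_i}$ for some $a_1,\dots,a_k\in\mathbb{N}$. Let $\mathcal{C}_{+1}$ be the category of $\mathfrak{o}_\ell$-linear functors from $\mathcal{C}$ to finite $\mathfrak{o}_\ell$-modules. For $F,G\in\mathcal{C}_{+1}$ write $G\prec F$ if $G$ is isomorphic to a subquotient of $F$ and $G\not\cong F$. Let $K$ be an algebraically closed field of characteristic zero. For $F\in\mathcal{C}_{+1}$ and $M\in\mathcal{C}$ let $KF(M)$ be the $K$-vector space with basis $\{u_m\mid m\in F(M)\}$, on which $g\in\mathrm{Aut}_R(M)$ acts by $u_m\mapsto u_{F(g)(m)}$. A natural automorphism $\alpha$ of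 $F$ induces the automorphism $\alpha_*:u_m\mapsto u_{\alpha_M(m)}$ of the representation $KF(M)$. **Theorem.** Let $F\in\mathcal{C}_{+1}$. 1. For every $M\in\mathcal{C}$, among the subrepresentations $W$ of $KF(M)$ with $\mathrm{Hom}_{\mathrm{Aut}_R(M)}(KG(M),W)=0$ for all $G\prec F$ there is a largest one, denoted $\overline{KF(M)}$. It is stable under all the maps $\alpha_*$, and the resulting $K$-algebra homomorphism $$\Phi_F(M):K\mathrm{Aut}_{\mathcal{C}_{+1}}(F)\to\mathrm{End}_{\mathrm{Aut}_R(M)}\bigl(\overline{KF(M)}\bigr),\qquad \alpha\mapsto\alpha_*|_{\overline{KF(M)}},$$ is surjective. 2. There is a constant $c\in\mathbb{N}$ such that $\Phi_F(M)$ is also injective for every $M\cong\bigoplus_{i=1}^k M_i^{a_i}$ with $a_i\ge c$ for all $i$. -/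

import Mathlib

open CategoryTheory

universe u v w t s

namespace FunctorMorphing

noncomputable section

section Categories

variable {R : Type v} [Ring R] {k : ℕ}

/-- `X` is isomorphic to the direct sum of `a i` copies of `N i`, for `i` in `Fin k`. -/
def HasMultiplicities (N : Fin k → ModuleCat.{w} R) (X : ModuleCat.{w} R) (a : Fin k → ℕ) : Prop :=
  Nonempty (X ≃ₗ[R] ((i : Fin k) → Fin (a i) → N i))

/-- The property of being isomorphic to a finite direct sum of copies of the modules `N i`. -/
def IsSumOf (N : Fin k → ModuleCat.{w} R) : ObjectProperty (ModuleCat.{w} R) :=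
  fun X => ∃ a : Fin k → ℕ, HasMultiplicities N X a

/-- The full subcategory `𝒞 = ⟨N 0, …, N (k - 1)⟩` of the category of left `R`-modules. -/
abbrev SumCat (N : Fin k → ModuleCat.{w} R) := (IsSumOf N).FullSubcategory

variable (A : Type u) [CommRing A] [Algebra A R] {N : Fin k → ModuleCat.{w} R}

variable {A} in
/-- The scalar multiple `r • f : x ↦ r • f x` of a morphism of `𝒞`, for `r` in the base ring `A` of
the algebra `R`. -/
def scalarMul {X Y : SumCat N} (r : A) (f : X ⟶ Y) : X ⟶ Y :=
  ObjectProperty.homMk (ModuleCat.ofHom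
    { toFun := fun x => algebraMap A R r • f.hom.hom x
      map_add' := fun x y => by rw [map_add, smul_add]
      map_smul' := fun c x => by
        rw [map_smul, RingHom.id_apply, smul_smul, smul_smul, Algebra.commutes] })

/-- The property of being an `A`-linear functor from `𝒞` with values in finite `A`-modules. -/
structure IsFiniteLinear (F : SumCat N ⥤ ModuleCat.{t} A) : Prop where
  finite_obj : ∀ X, Finite (F.obj X)
  map_add : ∀ {X Y : SumCat N} (f g : X ⟶ Y), F.map (f + g) = F.map f + F.map g
  map_scalarMul : ∀ {X Y : SumCat N} (r : A) (f : X ⟶ Y), F.map (scalarMul r f) = r • F.map f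

variable (N) in
/-- `IsFiniteLinear` as a property of the objects of the functor category. -/
def finiteLinear : ObjectProperty (SumCat N ⥤ ModuleCat.{t} A) := fun F => IsFiniteLinear A F

variable (N) in
/-- The category `𝒞₊₁` of `A`-linear functors from `𝒞` to finite `A`-modules, with all natural
transformations as morphisms. -/
abbrev FunctorCat := (finiteLinear.{u, v, w, t} A N).FullSubcategory

variable {A}

/-- `F ≼ G`: the functor `F` is isomorphic to a subquotient of `G`, that is, to a quotient of a
subfunctor `H` of `G`. -/
def IsSubquotient (F G : FunctorCat.{u, v, w, t} A N) : Prop :=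
  ∃ (H : FunctorCat.{u, v, w, t} A N) (i : H ⟶ G) (p : H ⟶ F),
    (∀ X, Function.Injective (i.hom.app X)) ∧ (∀ X, Function.Surjective (p.hom.app X))

/-- `F ≺ G`: the functor `F` is isomorphic to a subquotient of `G`, but not to `G`. -/
def StrictlyBelow (F G : FunctorCat.{u, v, w, t} A N) : Prop :=
  IsSubquotient F G ∧ ¬ Nonempty (F ≅ G)

end Categories

section Representations

variable {R : Type v} [Ring R] {k : ℕ} {N : Fin k → ModuleCat.{w} R}
  {A : Type u} [CommRing A] [Algebra A R]
  (K : Type s) [Field K]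

/-- The permutation representation `K F(M)` of `Aut_R(M)`: it has the basis `F(M)`, and `g` sends
the basis vector `u_m` to `u_{F(g)(m)}`. -/
def permRep (F : FunctorCat.{u, v, w, t} A N) (M : SumCat N) :
    Representation K (Aut M) (F.obj.obj M →₀ K) where
  toFun g := Finsupp.lmapDomain K K (F.obj.map g.hom)
  map_one' := by
    ext m : 2
    simp [show (1 : Aut M) = Iso.refl M from rfl]
  map_mul' g h := by
    ext m : 2
    have e : (g * h).hom = h.hom ≫ g.hom := rfl
    simp [e]

/-- The map `α_* : K F(M) → K G(M)` induced by a natural transformation, `u_m ↦ u_{α_M(m)}`. -/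
def pushforward {F G : FunctorCat.{u, v, w, t} A N} (α : F ⟶ G) (M : SumCat N) :
    (permRep K F M).IntertwiningMap (permRep K G M) where
  toLinearMap := Finsupp.lmapDomain K K (α.hom.app M)
  isIntertwining' g := by
    ext m : 2
    simp [permRep]

theorem pushforward_id (F : FunctorCat.{u, v, w, t} A N) (M : SumCat N) (x : F.obj.obj M →₀ K) :
    pushforward K (𝟙 F) M x = x := by
  change Finsupp.lmapDomain K K _ x = x
  simp

theorem pushforward_comp {F G H : FunctorCat.{u, v, w, t} A N} (α : F ⟶ G) (β : G ⟶ H)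
    (M : SumCat N) (x : F.obj.obj M →₀ K) :
    pushforward K (α ≫ β) M x = pushforward K β M (pushforward K α M x) := by
  change Finsupp.mapDomain _ x = Finsupp.mapDomain _ (Finsupp.mapDomain _ x)
  rw [← Finsupp.mapDomain_comp]
  rfl

variable {K}

/-- There are no non-zero maps of representations from `K G(M)` to `W`, for any `G ≺ F`. -/
def NoMapsFromBelow {F : FunctorCat.{u, v, w, t} A N} {M : SumCat N}
    (W : Subrepresentation (permRep K F M)) : Prop :=
  ∀ G : FunctorCat.{u, v, w, t} A N, StrictlyBelow G F →
    ∀ φ : (permRep K G M).IntertwiningMap W.toRepresentation, φ = 0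

variable (K)

/-- The representation `\overline{K F(M)}`: the join of all the subrepresentations of `K F(M)` that
receive no non-zero map from `K G(M)` for any `G ≺ F`. -/
def barRep (F : FunctorCat.{u, v, w, t} A N) (M : SumCat N) :
    Subrepresentation (permRep K F M) where
  toSubmodule := ⨆ W : {W : Subrepresentation (permRep K F M) // NoMapsFromBelow W},
    W.1.toSubmodule
  apply_mem_toSubmodule g v hv := by
    suffices h : (⨆ W : {W : Subrepresentation (permRep K F M) // NoMapsFromBelow W},
        W.1.toSubmodule) ≤ Submodule.comap (permRep K F M g)
          (⨆ W : {W : Subrepresentation (permRep K F M) // NoMapsFromBelow W},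
            W.1.toSubmodule) from h hv
    refine iSup_le fun W x hx => ?_
    exact Submodule.mem_iSup_of_mem W (W.1.apply_mem_toSubmodule g hx)

theorem pushforward_mem_barRep {F : FunctorCat.{u, v, w, t} A N} (α : Aut F) (M : SumCat N)
    {x : F.obj.obj M →₀ K} (hx : x ∈ (barRep K F M).toSubmodule) :
    pushforward K α.hom M x ∈ (barRep K F M).toSubmodule := by
  have hinv : ∀ y : F.obj.obj M →₀ K, pushforward K α.inv M (pushforward K α.hom M y) = y := by
    intro y
    rw [← pushforward_comp, α.hom_inv_id, pushforward_id]
  have hinv' : ∀ y : F.obj.obj M →₀ K, pushforward K α.hom M (pushforward K α.inv M y) = y := by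
    intro y
    rw [← pushforward_comp, α.inv_hom_id, pushforward_id]
  suffices h : (barRep K F M).toSubmodule ≤
      Submodule.comap (pushforward K α.hom M).toLinearMap (barRep K F M).toSubmodule from h hx
  refine iSup_le fun W => ?_
  intro y hy
  let W' : Subrepresentation (permRep K F M) :=
    { toSubmodule := Submodule.comap (pushforward K α.inv M).toLinearMap W.1.toSubmodule
      apply_mem_toSubmodule := fun g v hv => by
        have h := W.1.apply_mem_toSubmodule g hv
        rw [Submodule.mem_comap]
        rw [Representation.IntertwiningMap.toLinearMap_apply] at h ⊢
        rwa [Representation.IntertwiningMap.isIntertwining] }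
  have hW' : NoMapsFromBelow W' := by
    intro G hG φ
    have h0 := W.2 G hG
      { toLinearMap := ((pushforward K α.inv M).toLinearMap.restrict
          (p := W'.toSubmodule) (q := W.1.toSubmodule) (fun _ h => h)) ∘ₗ φ.toLinearMap
        isIntertwining' := by
          intro g
          refine LinearMap.ext fun z => Subtype.ext ?_
          have h1 : φ (permRep K G M g z) = W'.toRepresentation g (φ z) := φ.isIntertwining _ _ g z
          change pushforward K α.inv M (φ (permRep K G M g z)).1 = _
          rw [h1]
          exact (pushforward K α.inv M).isIntertwining _ _ g (φ z).1 }
    refine Representation.IntertwiningMap.ext (LinearMap.ext fun z => Subtype.ext ?_)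
    have h2 : pushforward K α.inv M (φ z).1 = 0 :=
      congrArg Subtype.val (DFunLike.congr_fun h0 z)
    have h3 := hinv' (φ z).1
    rw [h2, map_zero] at h3
    exact h3.symm
  refine Submodule.mem_iSup_of_mem ⟨W', hW'⟩ ?_
  change pushforward K α.inv M (pushforward K α.hom M y) ∈ W.1.toSubmodule
  rwa [hinv]

/-- The algebra homomorphism `Φ_F(M) : K Aut(F) → End(\overline{K F(M)})` that sends the basis vector
of `α` to the restriction of `α_*`. -/
def Phi (F : FunctorCat.{u, v, w, t} A N) (M : SumCat N) :
    MonoidAlgebra K (Aut F) →ₐ[K]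
      (barRep K F M).toRepresentation.IntertwiningMap (barRep K F M).toRepresentation :=
  MonoidAlgebra.lift K _ (Aut F)
    { toFun := fun α =>
        { toLinearMap := (pushforward K α.hom M).toLinearMap.restrict
            (fun _ hx => pushforward_mem_barRep K α M hx)
          isIntertwining' := fun g => by
            refine LinearMap.ext fun x => Subtype.ext ?_
            exact (pushforward K α.hom M).isIntertwining _ _ g x.1 }
      map_one' := by
        refine Representation.IntertwiningMap.ext (LinearMap.ext fun x => Subtype.ext ?_)
        exact pushforward_id K F M x.1
      map_mul' := fun α β => by
        refine Representation.IntertwiningMap.ext (LinearMap.ext fun x => Subtype.ext ?_)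
        exact pushforward_comp K β.hom α.hom M x.1 }

end Representations

end

end FunctorMorphing

/- A unit-invariant function on a finite module over a finite ring is a combination of indicator
functions of submodules, because generators of the same cyclic submodule are associated. Applied to
`F(M) × G(M)` over `End(M)`, this shows that the intertwining maps `KF(M) → KG(M)` are spanned by
linear relations. A relation on `F(M)` spreads to all objects of `C`, and so factors through a
subquotient of `F`. If that subquotient is isomorphic to `F`, the relation is the graph of an
automorphism of `F`; otherwise it lies in the ideal spanned by the endomorphisms that factor through
smaller functors, which by semisimplicity is the annihilator of `\overline{KF(M)}`. This gives
surjectivity. If the multiplicities are large, then all submodules of `F(M) × F(M)` are cyclic;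
hence distinct relations are linearly independent, and the ideal meets the span of the graphs
trivially. -/

namespace FunctorMorphing

section FiniteRings

theorem card_fiber_eq_of_range_eq {H Y : Type*} [AddGroup H] [Finite H] [AddGroup Y]
    {φ ψ : H →+ Y} (h : φ.range = ψ.range) (y : Y) :
    Nat.card {x // φ x = y} = Nat.card {x // ψ x = y} := by
  have card_fiber : ∀ χ : H →+ Y, χ.range = ψ.range → y ∈ ψ.range →
      Nat.card {x // χ x = y} = Nat.card χ.ker := by
    rintro χ hχ hy
    obtain ⟨x, rfl⟩ := hχ ▸ hy
    exact Nat.card_congr (χ.fiberEquivKer x)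
  have card_ker : Nat.card φ.ker = Nat.card ψ.ker := by
    have hφ := φ.ker.card_mul_index
    rw [← ψ.ker.card_mul_index, AddSubgroup.index_ker, AddSubgroup.index_ker, h] at hφ
    have : Finite ψ.range := Finite.of_surjective _ ψ.rangeRestrict_surjective
    exact Nat.eq_of_mul_eq_mul_right Nat.card_pos hφ
  by_cases hy : y ∈ ψ.range
  · rw [card_fiber φ h hy, card_ker, card_fiber ψ rfl hy]
  · have : IsEmpty {x // φ x = y} := ⟨fun x => hy (h ▸ ⟨x.1, x.2⟩)⟩
    have : IsEmpty {x // ψ x = y} := ⟨fun x => hy ⟨x.1, x.2⟩⟩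
    simp only [Nat.card_of_isEmpty]

theorem card_le_eq_add_sum_card_fiber {ι α : Type*} [PartialOrder ι] [Fintype ι] [Finite α]
    [DecidableLT ι] (f : α → ι) (i : ι) :
    Nat.card {a // i ≤ f a} =
      Nat.card {a // f a = i} + ∑ j with i < j, Nat.card {a // f a = j} := by
  classical
  have := Fintype.ofFinite α
  simp only [Nat.card_eq_fintype_card, Fintype.card_subtype]
  have lt_fiberwise : Finset.card {a | i < f a} = ∑ j with i < j, Finset.card {a | f a = j} := by
    rw [Finset.card_eq_sum_card_fiberwise (f := f) (t := {j | i < j}) fun a ha => by simpa using ha]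
    refine Finset.sum_congr rfl fun j hj => congrArg Finset.card ?_
    grind
  rw [← lt_fiberwise, ← Finset.card_union_of_disjoint]
  · congr 1
    grind [le_iff_eq_or_lt]
  · grind [Finset.disjoint_left]

theorem card_fiber_eq_of_card_le_eq {ι α β : Type*} [PartialOrder ι] [Finite ι] [Finite α]
    [Finite β] {f : α → ι} {g : β → ι}
    (h : ∀ i, Nat.card {a // i ≤ f a} = Nat.card {b // i ≤ g b}) (i : ι) :
    Nat.card {a // f a = i} = Nat.card {b // g b = i} := by
  classical
  have := Fintype.ofFinite ι
  induction i using WellFoundedGT.induction with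
  | ind i ih =>
  have hi := h i
  rwa [card_le_eq_add_sum_card_fiber, card_le_eq_add_sum_card_fiber,
    Finset.sum_congr rfl fun j hj => ih j (Finset.mem_filter.1 hj).2,
    Nat.add_right_cancel_iff] at hi

variable {S V : Type*} [Ring S] [AddCommGroup V] [Module S V] {v w : V}

theorem card_smul_eq_of_span_singleton_eq [Finite S]
    (h : Submodule.span S {v} = Submodule.span S {w}) (L : Ideal S) (y : V) :
    Nat.card {s : S // s • v = y ∧ L ≤ Ideal.torsionOf S S s} =
      Nat.card {s : S // s • w = y ∧ L ≤ Ideal.torsionOf S S s} := by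
  let H : AddSubgroup S :=
    { carrier := {s | L ≤ Ideal.torsionOf S S s}
      zero_mem' := by simp
      add_mem' := fun {s t} hs ht r hr => by
        have rs : r • s = 0 := hs hr
        have rt : r • t = 0 := ht hr
        rw [Ideal.mem_torsionOf_iff, smul_add, rs, rt, add_zero]
      neg_mem' := fun {s} hs r hr => by
        have rs : r • s = 0 := hs hr
        rw [Ideal.mem_torsionOf_iff, smul_neg, rs, neg_zero] }
  let eval (x : V) : H →+ V := (smulAddHom S V).flip x |>.comp H.subtype
  have range_le {v w : V} (hv : v ∈ Submodule.span S {w}) : (eval v).range ≤ (eval w).range := by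
    obtain ⟨a, rfl⟩ := Submodule.mem_span_singleton.1 hv
    rintro _ ⟨⟨s, hs⟩, rfl⟩
    refine ⟨⟨s * a, fun r hr => ?_⟩, mul_smul s a w⟩
    have rs : r * s = 0 := hs hr
    rw [Ideal.mem_torsionOf_iff, smul_eq_mul, ← mul_assoc, rs, zero_mul]
  have range_eq : (eval v).range = (eval w).range :=
    le_antisymm (range_le (h ▸ Submodule.mem_span_singleton_self v))
      (range_le (h ▸ Submodule.mem_span_singleton_self w))
  have card_eq (x : V) : Nat.card {s : S // s • x = y ∧ L ≤ Ideal.torsionOf S S s} =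
      Nat.card {s : H // eval x s = y} :=
    Nat.card_congr ⟨fun s => ⟨⟨s.1, s.2.2⟩, s.2.1⟩, fun s => ⟨s.1.1, s.2, s.1.2⟩,
      fun _ => rfl, fun _ => rfl⟩
  rw [card_eq, card_eq, card_fiber_eq_of_range_eq range_eq]

/- For every left ideal `L`, as many `s` with annihilator `L` satisfy `s • v = w` as satisfy
`s • w = w`; for `L = ⊥` the latter include `1`. -/
theorem exists_units_smul_eq [Finite S]
    (h : Submodule.span S {v} = Submodule.span S {w}) : ∃ u : Sˣ, u • v = w := by
  have : Finite (Ideal S) := Finite.of_injective _ SetLike.coe_injective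
  have card_eq := card_fiber_eq_of_card_le_eq
    (f := fun s : {s : S // s • v = w} => Ideal.torsionOf S S s.1)
    (g := fun s : {s : S // s • w = w} => Ideal.torsionOf S S s.1) (fun L => by
      have e := card_smul_eq_of_span_singleton_eq h L w
      rwa [← Nat.card_congr (Equiv.subtypeSubtypeEquivSubtypeInter _ _),
        ← Nat.card_congr (Equiv.subtypeSubtypeEquivSubtypeInter _ _)] at e) ⊥
  have torsionOf_one : Ideal.torsionOf S S 1 = ⊥ := by
    ext
    simp
  have : Nonempty {s : {s : S // s • w = w} // Ideal.torsionOf S S s.1 = ⊥} :=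
    ⟨⟨1, one_smul S w⟩, torsionOf_one⟩
  obtain ⟨⟨⟨⟨s, hs⟩, hs0⟩⟩, -⟩ := Nat.card_pos_iff.1 (card_eq.symm ▸ Nat.card_pos)
  have regular : IsRightRegular s := by
    intro a b hab
    have : a - b ∈ Ideal.torsionOf S S s := by
      rw [Ideal.mem_torsionOf_iff, smul_eq_mul, sub_mul, sub_eq_zero]
      exact hab
    rwa [hs0, Ideal.mem_bot, sub_eq_zero] at this
  obtain ⟨u, rfl⟩ := regular.isUnit_of_finite
  exact ⟨u, hs⟩
end FiniteRings

section Indicators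

variable (K : Type*) {S V : Type*} [Ring K] [Ring S] [AddCommGroup V] [Module S V]

/-- The indicator function of a submodule, with values in `K`. -/
noncomputable def submoduleIndicator (L : Submodule S V) : V → K := (L : Set V).indicator 1

open Classical in
theorem submoduleIndicator_apply (L : Submodule S V) (x : V) :
    submoduleIndicator K L x = if x ∈ L then 1 else 0 := rfl

theorem submoduleIndicator_of_mem {L : Submodule S V} {x : V} (hx : x ∈ L) :
    submoduleIndicator K L x = 1 := Set.indicator_of_mem (s := (L : Set V)) hx 1

theorem submoduleIndicator_of_notMem {L : Submodule S V} {x : V} (hx : x ∉ L) :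
    submoduleIndicator K L x = 0 := Set.indicator_of_notMem (s := (L : Set V)) hx 1

variable [Finite V]

theorem indicator_generators_mem_span (L : Submodule S V) :
    {x | Submodule.span S {x} = L}.indicator (1 : V → K) ∈
      Submodule.span K (Set.range (submoduleIndicator (S := S) (V := V) K)) := by
  classical
  have : Finite (Submodule S V) := Finite.of_injective _ SetLike.coe_injective
  have := Fintype.ofFinite (Submodule S V)
  induction L using WellFoundedLT.induction with
  | ind L ih =>
  have sub_smaller : {x | Submodule.span S {x} = L}.indicator (1 : V → K) =
      submoduleIndicator K L -
        ∑ L' with L' < L, {x | Submodule.span S {x} = L'}.indicator (1 : V → K) := by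
    funext x
    simp only [Pi.sub_apply, Finset.sum_apply, submoduleIndicator_apply, Set.indicator_apply,
      Set.mem_ofPred_eq, Pi.one_apply, Finset.sum_ite_eq, Finset.mem_filter_univ,
      ← Submodule.span_singleton_le_iff_mem x L, le_iff_lt_or_eq]
    grind
  rw [sub_smaller]
  exact Submodule.sub_mem _ (Submodule.subset_span ⟨L, rfl⟩)
    (Submodule.sum_mem _ fun L' hlt => ih L' (Finset.mem_filter.1 hlt).2)

theorem mem_span_submoduleIndicator_of_factorsThrough {f : V → K}
    (hf : f.FactorsThrough fun x => Submodule.span S {x}) :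
    f ∈ Submodule.span K (Set.range (submoduleIndicator (S := S) (V := V) K)) := by
  classical
  have : Finite (Submodule S V) := Finite.of_injective _ SetLike.coe_injective
  have := Fintype.ofFinite (Submodule S V)
  let c : Submodule S V → K := Function.extend (fun x => Submodule.span S {x}) f 0
  have f_eq_sum : f = ∑ L, c L • {x | Submodule.span S {x} = L}.indicator (1 : V → K) := by
    funext x
    simp only [Finset.sum_apply, Pi.smul_apply, Set.indicator_apply, Set.mem_ofPred_eq,
      Pi.one_apply, smul_eq_mul, mul_ite, mul_one, mul_zero, Finset.sum_ite_eq, Finset.mem_univ,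
      if_true]
    exact (hf.extend_apply 0 x).symm
  rw [f_eq_sum]
  exact Submodule.sum_mem _ fun L _ => Submodule.smul_mem _ _ (indicator_generators_mem_span K L)

theorem mem_span_submoduleIndicator_of_units_smul [Finite S] {f : V → K}
    (hf : ∀ (u : Sˣ) x, f (u • x) = f x) :
    f ∈ Submodule.span K (Set.range (submoduleIndicator (S := S) (V := V) K)) := by
  refine mem_span_submoduleIndicator_of_factorsThrough K fun x y hxy => ?_
  obtain ⟨u, rfl⟩ := exists_units_smul_eq hxy
  exact (hf u x).symm

theorem linearIndependent_submoduleIndicator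
    (h : ∀ L : Submodule S V, ∃ x, Submodule.span S {x} = L) :
    LinearIndependent K (submoduleIndicator (S := S) (V := V) K) := by
  have : Finite (Submodule S V) := Finite.of_injective _ SetLike.coe_injective
  have := Fintype.ofFinite (Submodule S V)
  rw [Fintype.linearIndependent_iff]
  intro c hc L
  induction L using WellFoundedGT.induction with
  | ind L ih =>
  obtain ⟨x, rfl⟩ := h L
  have eval_generator := congrFun hc x
  rw [Finset.sum_apply, Finset.sum_eq_single_of_mem _ (Finset.mem_univ (Submodule.span S {x}))]
    at eval_generator
  · rwa [Pi.smul_apply, submoduleIndicator_of_mem K (Submodule.mem_span_singleton_self x),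
      smul_eq_mul, mul_one] at eval_generator
  · intro L' _ hne
    by_cases hx : x ∈ L'
    · rw [Pi.smul_apply, ih L' (lt_of_le_of_ne
        ((Submodule.span_singleton_le_iff_mem x L').2 hx) hne.symm), zero_smul]
    · rw [Pi.smul_apply, submoduleIndicator_of_notMem K hx, smul_zero]

end Indicators

section Semisimplicity

open Representation

theorem exists_linear_quasiInverse {K V W : Type*} [Field K] [AddCommGroup V] [Module K V]
    [AddCommGroup W] [Module K W] (f : V →ₗ[K] W) : ∃ g : W →ₗ[K] V, f ∘ₗ g ∘ₗ f = f := by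
  obtain ⟨r, hr⟩ := f.rangeRestrict.exists_rightInverse_of_surjective f.range_rangeRestrict
  obtain ⟨g, hg⟩ := r.exists_extend
  refine ⟨g, LinearMap.ext fun v => ?_⟩
  have g_apply : g (f v) = r (f.rangeRestrict v) := LinearMap.congr_fun hg (f.rangeRestrict v)
  rw [LinearMap.comp_apply, LinearMap.comp_apply, g_apply]
  exact congrArg Subtype.val (LinearMap.congr_fun hr (f.rangeRestrict v))

variable {Γ K V W : Type*} [Group Γ] [Field K] [AddCommGroup V] [Module K V] [AddCommGroup W]
  [Module K W] {ρ : Representation K Γ V} {σ : Representation K Γ W}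

/-- The inclusion of a subrepresentation. -/
def subrepInclusion (U : Subrepresentation ρ) : U.toRepresentation.IntertwiningMap ρ where
  toLinearMap := U.toSubmodule.subtype
  isIntertwining' _ := rfl

/-- Passing to the underlying linear map, as a linear map. -/
def toLinearMapHom (ρ : Representation K Γ V) (σ : Representation K Γ W) :
    ρ.IntertwiningMap σ →ₗ[K] V →ₗ[K] W where
  toFun f := f.toLinearMap
  map_add' _ _ := rfl
  map_smul' _ _ := rfl

variable [Finite Γ] [CharZero K]

theorem exists_quasiInverse (f : ρ.IntertwiningMap σ) :
    ∃ g : σ.IntertwiningMap ρ, ∀ v, f (g (f v)) = f v := by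
  have := Fintype.ofFinite Γ
  have : Invertible (Fintype.card Γ : K) := invertibleOfNonzero (by simp)
  obtain ⟨g, hg⟩ := exists_linear_quasiInverse f.toLinearMap
  have comp_average : f.toLinearMap ∘ₗ averageMap (linHom σ ρ) g ∘ₗ f.toLinearMap =
      averageMap (linHom ρ σ) (f.toLinearMap ∘ₗ g ∘ₗ f.toLinearMap) := by
    ext v
    simp [GroupAlgebra.average, map_sum, LinearMap.sum_apply, f.isIntertwining]
  have f_invariant : f.toLinearMap ∈ invariants (linHom ρ σ) :=
    ((invariantsEquivIntertwiningMap ρ σ).symm f).2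
  rw [hg, averageMap_id _ _ f_invariant] at comp_average
  exact ⟨invariantsEquivIntertwiningMap σ ρ ⟨_, averageMap_invariant _ g⟩,
    LinearMap.congr_fun comp_average⟩

theorem exists_intertwiningProjection (U : Subrepresentation ρ) :
    ∃ π : ρ.IntertwiningMap U.toRepresentation, ∀ x : U.toSubmodule, π x = x := by
  obtain ⟨π, hπ⟩ := exists_quasiInverse (subrepInclusion U)
  exact ⟨π, fun x => Subtype.ext (hπ x)⟩

theorem exists_right_identity_of_ideal [Module.Finite K V] (J : Ideal (ρ.IntertwiningMap ρ)) :
    ∃ e ∈ J, ∀ z ∈ J, z * e = z := by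
  have : NeZero (Nat.card Γ : K) := ⟨Nat.cast_ne_zero.2 Nat.card_pos.ne'⟩
  have : Module.Finite (MonoidAlgebra K Γ) ρ.asModule :=
    Module.Finite.of_restrictScalars_finite K _ _
  have : IsSemisimpleRing (Module.End (MonoidAlgebra K Γ) ρ.asModule) := .moduleEnd _ _
  let Ψ := IntertwiningMap.equivAlgEnd ρ
  obtain ⟨e, he, span_e⟩ := IsSemisimpleRing.ideal_eq_span_idempotent (J.comap Ψ.symm)
  refine ⟨Ψ.symm e, Ideal.mem_comap.1 (span_e ▸ Ideal.mem_span_singleton_self e), fun z hz => ?_⟩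
  have hΨz : Ψ z ∈ Ideal.span {e} := span_e ▸ Ideal.mem_comap.2 (by rwa [Ψ.symm_apply_apply])
  obtain ⟨a, ha⟩ := Submodule.mem_span_singleton.1 hΨz
  rw [← Ψ.symm_apply_apply z, ← ha, ← map_mul, smul_eq_mul, mul_assoc, he.eq]

end Semisimplicity

section Relations

section Kernels

variable (K V W : Type*) {U : Type*} [Field K] [Finite W] [Finite U]

/-- The linear maps between the spaces with bases `V` and `W` and their matrices: the function `f`
corresponds to the map `u_x ↦ ∑ y, f (x, y) • u_y`. -/
noncomputable def kernelEquiv : (V × W → K) ≃ₗ[K] ((V →₀ K) →ₗ[K] (W →₀ K)) :=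
  LinearEquiv.curry K K V W ≪≫ₗ
    LinearEquiv.piCongrRight (fun _ => (Finsupp.linearEquivFunOnFinite K K W).symm) ≪≫ₗ
    Finsupp.llift (W →₀ K) K K V

variable {V W}

@[simp]
theorem kernelEquiv_single (f : V × W → K) (x : V) (y : W) :
    kernelEquiv K V W f (Finsupp.single x 1) y = f (x, y) := by
  simp [kernelEquiv]

theorem kernelEquiv_eq_iff {f : V × W → K} {T : (V →₀ K) →ₗ[K] (W →₀ K)} :
    kernelEquiv K V W f = T ↔ ∀ x y, f (x, y) = T (Finsupp.single x 1) y := by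
  refine ⟨fun h x y => h ▸ (kernelEquiv_single K f x y).symm, fun h => ?_⟩
  ext x y
  simp [h]

theorem kernelEquiv_comp [Fintype W] (f : V × W → K) (g : W × U → K) :
    kernelEquiv K W U g ∘ₗ kernelEquiv K V W f =
      kernelEquiv K V U fun p => ∑ y, f (p.1, y) * g (y, p.2) := by
  symm
  rw [kernelEquiv_eq_iff]
  intro x z
  have expand : kernelEquiv K V W f (Finsupp.single x 1) =
      ∑ y, f (x, y) • Finsupp.single y (1 : K) := by
    classical
    ext y
    simp [Finsupp.finsetSum_apply, Finsupp.single_apply]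
  simp only [LinearMap.comp_apply, expand, map_sum, Finsupp.finsetSum_apply, map_smul,
    Finsupp.smul_apply, kernelEquiv_single, smul_eq_mul]

end Kernels

variable {S V W U C : Type*} [Ring S] [AddCommGroup V] [Module S V] [AddCommGroup W] [Module S W]
  [AddCommGroup U] [Module S U] [AddCommGroup C] [Module S C]

/-- The composite of two linear relations. -/
def relComp (L : Submodule S (V × W)) (L' : Submodule S (W × U)) : Submodule S (V × U) where
  carrier := {p | ∃ y, (p.1, y) ∈ L ∧ (y, p.2) ∈ L'}
  zero_mem' := ⟨0, L.zero_mem, L'.zero_mem⟩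
  add_mem' := by
    rintro p q ⟨y, h1, h2⟩ ⟨z, h3, h4⟩
    exact ⟨y + z, L.add_mem h1 h3, L'.add_mem h2 h4⟩
  smul_mem' := by
    rintro c p ⟨y, h1, h2⟩
    exact ⟨c • y, L.smul_mem c h1, L'.smul_mem c h2⟩

theorem mem_relComp {L : Submodule S (V × W)} {L' : Submodule S (W × U)} {p : V × U} :
    p ∈ relComp L L' ↔ ∃ y, (p.1, y) ∈ L ∧ (y, p.2) ∈ L' := Iff.rfl

theorem relComp_eq_of_subquotient {L : Submodule S (V × W)} {i : C →ₗ[S] W} {p : C →ₗ[S] U}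
    (range_i : ∀ x y, (x, y) ∈ L → y ∈ LinearMap.range i)
    (ker_p : ∀ c, p c = 0 → (0, i c) ∈ L) :
    relComp ((L.comap (LinearMap.id.prodMap i)).map (LinearMap.id.prodMap p))
      (LinearMap.range (p.prod i)) = L := by
  ext ⟨x, y⟩
  constructor
  · rintro ⟨q, ⟨⟨x, c⟩, hxc, ⟨⟩⟩, ⟨c', hc'⟩⟩
    obtain ⟨hp, rfl⟩ := Prod.ext_iff.1 hc'
    have diff_mem : (0, i (c' - c)) ∈ L := ker_p _ (by rw [map_sub, sub_eq_zero]; exact hp)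
    simpa using L.add_mem hxc diff_mem
  · intro hxy
    obtain ⟨c, rfl⟩ := range_i x y hxy
    exact ⟨p c, ⟨(x, c), hxy, rfl⟩, ⟨c, rfl⟩⟩

theorem exists_linearEquiv_eq_graph [Finite V] {L : Submodule S (V × V)}
    (total : ∀ y, ∃ x, (x, y) ∈ L) (single_valued : ∀ y, (0, y) ∈ L → y = 0) :
    ∃ e : V ≃ₗ[S] V, L = e.toLinearMap.graph := by
  have fst_injective : Function.Injective (LinearMap.fst S V V ∘ₗ L.subtype) := by
    refine LinearMap.ker_eq_bot.1 (LinearMap.ker_eq_bot'.2 ?_)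
    rintro ⟨⟨x, y⟩, hxy⟩ (rfl : x = 0)
    exact Subtype.ext (Prod.ext rfl (single_valued y hxy))
  have snd_surjective : Function.Surjective (LinearMap.snd S V V ∘ₗ L.subtype) := fun y =>
    let ⟨x, hxy⟩ := total y
    ⟨⟨(x, y), hxy⟩, rfl⟩
  exact Submodule.exists_equiv_eq_graph
    (fst_injective.bijective_of_nat_card_le (Nat.card_le_card_of_surjective _ snd_surjective))
    (snd_surjective.bijective_of_nat_card_le (Nat.card_le_card_of_injective _ fst_injective))

theorem card_intermediate {L : Submodule S (V × W)} {L' : Submodule S (W × U)} {p : V × U}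
    (hp : p ∈ relComp L L') :
    Nat.card {y // (p.1, y) ∈ L ∧ (y, p.2) ∈ L'} = Nat.card {y // (0, y) ∈ L ∧ (y, 0) ∈ L'} := by
  obtain ⟨y₀, h1, h2⟩ := hp
  refine Nat.card_congr ((Equiv.subRight y₀).subtypeEquiv fun y => ?_)
  have e1 : (0, y - y₀) ∈ L ↔ (p.1, y) ∈ L := by
    simpa using L.sub_mem_iff_left (x := (p.1, y)) h1
  have e2 : (y - y₀, 0) ∈ L' ↔ (y, p.2) ∈ L' := by
    simpa using L'.sub_mem_iff_left (x := (y, p.2)) h2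
  rw [Equiv.subRight_apply, e1, e2]

variable [Finite W] [Finite U] (K : Type*) [Field K]

/-- The linear map `u_x ↦ ∑ u_y`, with `y` ranging over the elements related to `x` under the
linear relation `L`. -/
noncomputable def relMap (L : Submodule S (V × W)) : (V →₀ K) →ₗ[K] (W →₀ K) :=
  kernelEquiv K V W (submoduleIndicator K L)

theorem relMap_comp (L : Submodule S (V × W)) (L' : Submodule S (W × U)) :
    relMap K L' ∘ₗ relMap K L =
      (Nat.card {y // (0, y) ∈ L ∧ (y, 0) ∈ L'} : K) • relMap K (relComp L L') := by
  classical
  have := Fintype.ofFinite W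
  rw [relMap, relMap, relMap, kernelEquiv_comp, ← map_smul]
  refine congrArg (kernelEquiv K V U) (funext fun p => ?_)
  have sum_eq_card : ∑ y, submoduleIndicator K L (p.1, y) * submoduleIndicator K L' (y, p.2) =
      (Nat.card {y // (p.1, y) ∈ L ∧ (y, p.2) ∈ L'} : K) := by
    simp only [submoduleIndicator_apply, ite_mul, one_mul, zero_mul, ← ite_and, Finset.sum_boole,
      Nat.card_eq_fintype_card, Fintype.card_subtype]
  rw [sum_eq_card, Pi.smul_apply, smul_eq_mul]
  by_cases hp : p ∈ relComp L L'
  · rw [card_intermediate hp, submoduleIndicator_of_mem K hp, mul_one]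
  · have : IsEmpty {y // (p.1, y) ∈ L ∧ (y, p.2) ∈ L'} := ⟨fun y => hp ⟨y, y.2⟩⟩
    rw [submoduleIndicator_of_notMem K hp, mul_zero, Nat.card_of_isEmpty, Nat.cast_zero]

theorem linearIndependent_relMap [Finite V]
    (h : ∀ L : Submodule S (V × W), ∃ x, Submodule.span S {x} = L) :
    LinearIndependent K (relMap K : Submodule S (V × W) → _) := by
  have indep := linearIndependent_submoduleIndicator K h
  rw [linearIndependent_iff_injective_finsuppLinearCombination] at indep ⊢
  have factorization : Finsupp.linearCombination K (relMap K : Submodule S (V × W) → _) =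
      (kernelEquiv K V W).toLinearMap ∘ₗ Finsupp.linearCombination K (submoduleIndicator K) := by
    ext
    simp [relMap]
  rw [factorization]
  exact (kernelEquiv K V W).injective.comp indep

end Relations

section Functors

variable {R : Type v} [Ring R] {k : ℕ} {N : Fin k → ModuleCat.{w} R}
  {A : Type u} [CommRing A] [Algebra A R] {F G : FunctorCat.{u, v, w, t} A N}

instance finite_obj (F : FunctorCat.{u, v, w, t} A N) (X : SumCat N) : Finite (F.obj.obj X) :=
  F.property.finite_obj X

theorem map_id_apply {X : SumCat N} (x : F.obj.obj X) : F.obj.map (𝟙 X) x = x := by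
  simp

theorem map_comp_apply {X Y Z : SumCat N} (f : X ⟶ Y) (g : Y ⟶ Z) (x : F.obj.obj X) :
    F.obj.map (f ≫ g) x = F.obj.map g (F.obj.map f x) := by
  simp

theorem map_add_apply {X Y : SumCat N} (f g : X ⟶ Y) (x : F.obj.obj X) :
    F.obj.map (f + g) x = F.obj.map f x + F.obj.map g x := by
  rw [F.property.map_add]
  rfl

theorem map_zero_apply {X Y : SumCat N} (x : F.obj.obj X) :
    F.obj.map (0 : X ⟶ Y) x = 0 := by
  have h := map_add_apply (0 : X ⟶ Y) 0 x
  rwa [add_zero, left_eq_add] at h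

theorem map_sum_apply {X Y : SumCat N} {ι : Type*} (s : Finset ι) (f : ι → (X ⟶ Y))
    (x : F.obj.obj X) : F.obj.map (∑ i ∈ s, f i) x = ∑ i ∈ s, F.obj.map (f i) x := by
  classical
  induction s using Finset.induction_on with
  | empty => simpa using map_zero_apply x
  | insert i s hi ih => rw [Finset.sum_insert hi, Finset.sum_insert hi, map_add_apply, ih]

theorem map_scalarMul_apply {X Y : SumCat N} (r : A) (f : X ⟶ Y) (x : F.obj.obj X) :
    F.obj.map (scalarMul r f) x = r • F.obj.map f x := by
  rw [F.property.map_scalarMul]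
  rfl

theorem app_map_apply (α : F ⟶ G) {X Y : SumCat N} (f : X ⟶ Y) (x : F.obj.obj X) :
    α.hom.app Y (F.obj.map f x) = G.obj.map f (α.hom.app X x) :=
  NatTrans.naturality_apply α.hom f x

/-- The values of a linear functor at `M` form a left module over the endomorphism ring of `M`. -/
instance endModule (F : FunctorCat.{u, v, w, t} A N) (M : SumCat N) :
    Module (End M) (F.obj.obj M) where
  smul r x := F.obj.map r x
  one_smul x := map_id_apply x
  mul_smul r s x := map_comp_apply s r x
  smul_zero r := map_zero (F.obj.map r).hom
  smul_add r := map_add (F.obj.map r).hom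
  add_smul r s x := map_add_apply r s x
  zero_smul x := map_zero_apply x

/-- A natural transformation with bijective components is an isomorphism. -/
noncomputable def isoOfBijective (α : F ⟶ G) (h : ∀ X, Function.Bijective (α.hom.app X)) : F ≅ G :=
  ObjectProperty.isoMk _ (NatIso.ofComponents
    (fun X => (LinearEquiv.ofBijective (α.hom.app X).hom (h X)).toModuleIso)
    (fun f => α.hom.naturality f))

/-- A family of submodules of the values of a functor that is stable under the functor. -/
structure StableFamily (F : FunctorCat.{u, v, w, t} A N) where
  /-- The submodules. -/
  obj : ∀ X, Submodule A (F.obj.obj X)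
  map_mem : ∀ {X Y : SumCat N} (f : X ⟶ Y) {x}, x ∈ obj X → F.obj.map f x ∈ obj Y

namespace StableFamily

/-- A stable family as a functor. -/
noncomputable def sub (P : StableFamily F) : FunctorCat.{u, v, w, t} A N where
  obj :=
    { obj := fun X => ModuleCat.of A (P.obj X)
      map := fun f => ModuleCat.ofHom ((F.obj.map f).hom.restrict fun _ => P.map_mem f)
      map_id := fun X => by
        refine ModuleCat.hom_ext (LinearMap.ext fun x => Subtype.ext ?_)
        exact map_id_apply x.1
      map_comp := fun f g => by
        refine ModuleCat.hom_ext (LinearMap.ext fun x => Subtype.ext ?_)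
        exact map_comp_apply f g x.1 }
  property :=
    { finite_obj := fun X => (inferInstance : Finite (P.obj X))
      map_add := fun f g => by
        refine ModuleCat.hom_ext (LinearMap.ext fun x => Subtype.ext ?_)
        exact map_add_apply f g x.1
      map_scalarMul := fun r f => by
        refine ModuleCat.hom_ext (LinearMap.ext fun x => Subtype.ext ?_)
        exact map_scalarMul_apply r f x.1 }

/-- The inclusion of a subfunctor. -/
noncomputable def incl (P : StableFamily F) : P.sub ⟶ F :=
  ObjectProperty.homMk
    { app := fun X => ModuleCat.ofHom (P.obj X).subtype
      naturality := fun _ _ _ => rfl }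

/-- The quotient of a functor by a stable family. -/
noncomputable def quot (P : StableFamily F) : FunctorCat.{u, v, w, t} A N where
  obj :=
    { obj := fun X => ModuleCat.of A (F.obj.obj X ⧸ P.obj X)
      map := fun f =>
        ModuleCat.ofHom (Submodule.mapQ _ _ (F.obj.map f).hom fun _ => P.map_mem f)
      map_id := fun X => by
        ext x
        exact congrArg (Submodule.mkQ _) (map_id_apply x)
      map_comp := fun f g => by
        ext x
        exact congrArg (Submodule.mkQ _) (map_comp_apply f g x) }
  property :=
    { finite_obj := fun X => Finite.of_surjective _ (Submodule.mkQ_surjective (P.obj X))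
      map_add := fun f g => by
        ext x
        exact congrArg (Submodule.mkQ _) (map_add_apply f g x)
      map_scalarMul := fun r f => by
        ext x
        exact congrArg (Submodule.mkQ _) (map_scalarMul_apply r f x) }

/-- The projection onto a quotient functor. -/
noncomputable def proj (P : StableFamily F) : F ⟶ P.quot :=
  ObjectProperty.homMk
    { app := fun X => ModuleCat.ofHom (P.obj X).mkQ
      naturality := fun _ _ _ => rfl }

theorem incl_injective (P : StableFamily F) (X : SumCat N) :
    Function.Injective (P.incl.hom.app X) := Subtype.val_injective

theorem proj_surjective (P : StableFamily F) (X : SumCat N) :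
    Function.Surjective (P.proj.hom.app X) := Submodule.mkQ_surjective _

end StableFamily

theorem card_obj_eq_of_iso (e : F ≅ G) (X : SumCat N) :
    Nat.card (F.obj.obj X) = Nat.card (G.obj.obj X) :=
  Nat.card_congr (((ObjectProperty.ι _).mapIso e).app X).toLinearEquiv.toEquiv

theorem bijective_of_card_le {H : FunctorCat.{u, v, w, t} A N} {i : H ⟶ F} {p : H ⟶ G}
    {X : SumCat N} (hi : Function.Injective (i.hom.app X)) (hp : Function.Surjective (p.hom.app X))
    (h : Nat.card (F.obj.obj X) ≤ Nat.card (G.obj.obj X)) :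
    Function.Bijective (i.hom.app X) ∧ Function.Bijective (p.hom.app X) := by
  have H_le_F := Nat.card_le_card_of_injective _ hi
  have G_le_H := Nat.card_le_card_of_surjective _ hp
  exact ⟨hi.bijective_of_nat_card_le (h.trans G_le_H),
    hp.bijective_of_nat_card_le (H_le_F.trans h)⟩

/-- A stable family of linear relations between two functors. -/
structure StableRelation (F G : FunctorCat.{u, v, w, t} A N) where
  /-- The relations. -/
  obj : ∀ X, Submodule A (F.obj.obj X × G.obj.obj X)
  map_mem : ∀ {X Y : SumCat N} (f : X ⟶ Y) {x y}, (x, y) ∈ obj X →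
    (F.obj.map f x, G.obj.map f y) ∈ obj Y

namespace StableRelation

/-- A relation at `M` that is linear over the endomorphism ring of `M` extends to a stable family
of relations. -/
noncomputable def extend {M : SumCat N} (L : Submodule (End M) (F.obj.obj M × G.obj.obj M)) :
    StableRelation F G where
  obj X :=
    { carrier := {p | ∀ f : X ⟶ M, (F.obj.map f p.1, G.obj.map f p.2) ∈ L}
      zero_mem' := fun f => by
        have h : ((F.obj.map f).hom 0, (G.obj.map f).hom 0) ∈ L := by
          rw [map_zero, map_zero]
          exact L.zero_mem
        exact h
      add_mem' := fun {p q} hp hq f => by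
        have h : ((F.obj.map f).hom (p.1 + q.1), (G.obj.map f).hom (p.2 + q.2)) ∈ L := by
          rw [map_add, map_add]
          exact L.add_mem (hp f) (hq f)
        exact h
      smul_mem' := fun c p hp f => by
        have h := hp (scalarMul c f)
        rw [map_scalarMul_apply, map_scalarMul_apply] at h
        have h' : ((F.obj.map f).hom (c • p.1), (G.obj.map f).hom (c • p.2)) ∈ L := by
          rw [map_smul, map_smul]
          exact h
        exact h' }
  map_mem := by
    intro X Y f x y h g
    have := h (f ≫ g)
    rwa [map_comp_apply, map_comp_apply] at this

theorem mem_extend {M X : SumCat N} {L : Submodule (End M) (F.obj.obj M × G.obj.obj M)}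
    {x : F.obj.obj X} {y : G.obj.obj X} : (x, y) ∈ (extend L).obj X ↔
      ∀ f : X ⟶ M, (F.obj.map f x, G.obj.map f y) ∈ L := Iff.rfl

theorem mem_extend_self {M : SumCat N} {L : Submodule (End M) (F.obj.obj M × G.obj.obj M)}
    {x : F.obj.obj M} {y : G.obj.obj M} : (x, y) ∈ (extend L).obj M ↔ (x, y) ∈ L := by
  refine ⟨fun h => ?_, fun h f => L.smul_mem (f : End M) h⟩
  have := mem_extend.1 h (𝟙 M)
  rwa [map_id_apply, map_id_apply] at this

/-- The elements of `G` that are related to some element of `F`. -/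
noncomputable def codomain (H : StableRelation F G) : StableFamily G where
  obj X := (H.obj X).map (LinearMap.snd A _ _)
  map_mem := by
    intro X Y f y h
    obtain ⟨⟨x, y⟩, h, rfl⟩ := h
    exact ⟨(F.obj.map f x, G.obj.map f y), H.map_mem f h, rfl⟩

theorem mem_codomain {H : StableRelation F G} {X : SumCat N} {y : G.obj.obj X} :
    y ∈ H.codomain.obj X ↔ ∃ x, (x, y) ∈ H.obj X := by
  constructor
  · rintro ⟨⟨x, y⟩, h, rfl⟩
    exact ⟨x, h⟩
  · rintro ⟨x, h⟩
    exact ⟨(x, y), h, rfl⟩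

/-- The elements of the codomain that are related to zero. -/
noncomputable def indeterminacy (H : StableRelation F G) : StableFamily H.codomain.sub where
  obj X := ((H.obj X).comap (LinearMap.inr A _ _)).comap (H.codomain.obj X).subtype
  map_mem := by
    intro X Y f y h
    have map_mem := H.map_mem f (show ((0 : F.obj.obj X), y.1) ∈ H.obj X from h)
    have map_zero : F.obj.map f (0 : F.obj.obj X) = 0 := map_zero (F.obj.map f).hom
    rwa [map_zero] at map_mem

/-- The codomain modulo the indeterminacy. -/
noncomputable def core (H : StableRelation F G) : FunctorCat.{u, v, w, t} A N :=
  H.indeterminacy.quot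

theorem isSubquotient_core (H : StableRelation F G) : IsSubquotient H.core G :=
  ⟨H.codomain.sub, H.codomain.incl, H.indeterminacy.proj, H.codomain.incl_injective,
    H.indeterminacy.proj_surjective⟩

theorem exists_aut (H : StableRelation F F) (total : ∀ X y, ∃ x, (x, y) ∈ H.obj X)
    (single_valued : ∀ X y, ((0 : F.obj.obj X), y) ∈ H.obj X → y = 0) :
    ∃ α : Aut F, ∀ X x y, (x, y) ∈ H.obj X ↔ α.hom.hom.app X x = y := by
  choose e graph_e using fun X => exists_linearEquiv_eq_graph (total X) (single_valued X)
  have mem_iff : ∀ X x y, (x, y) ∈ H.obj X ↔ e X x = y := fun X x y => by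
    rw [graph_e, LinearMap.mem_graph_iff]
    exact eq_comm
  let α : F ⟶ F := ObjectProperty.homMk
    { app := fun X => (e X).toModuleIso.hom
      naturality := fun X Y f => by
        ext x
        exact (mem_iff Y _ _).1 (H.map_mem f ((mem_iff X x _).2 rfl)) }
  exact ⟨isoOfBijective α fun X => (e X).bijective, mem_iff⟩

theorem exists_aut_of_iso (H : StableRelation F F) (e : H.core ≅ F) :
    ∃ α : Aut F, ∀ X x y, (x, y) ∈ H.obj X ↔ α.hom.hom.app X x = y := by
  have hb := fun X => bijective_of_card_le (H.codomain.incl_injective X)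
    (H.indeterminacy.proj_surjective X) (card_obj_eq_of_iso e.symm X).le
  refine H.exists_aut (fun X y => ?_) (fun X y hy => ?_)
  · obtain ⟨z, rfl⟩ := (hb X).1.2 y
    exact mem_codomain.1 z.2
  · let z : H.codomain.sub.obj.obj X := ⟨y, mem_codomain.2 ⟨0, hy⟩⟩
    have proj_eq_zero : H.indeterminacy.proj.hom.app X z = 0 :=
      (Submodule.Quotient.mk_eq_zero _).2 hy
    exact congrArg Subtype.val (((hb X).2.1 (proj_eq_zero.trans (map_zero _).symm)) : z = 0)

end StableRelation

/-- A component of a natural transformation, as a linear map over the endomorphism ring. -/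
noncomputable def appEnd (α : F ⟶ G) (M : SumCat N) : F.obj.obj M →ₗ[End M] G.obj.obj M where
  toFun := α.hom.app M
  map_add' := map_add (α.hom.app M).hom
  map_smul' r x := app_map_apply α r x

end Functors

section Intertwiners

open Representation

variable {K : Type s} [Field K] {R : Type v} [Ring R] {k : ℕ} {N : Fin k → ModuleCat.{w} R}
  {A : Type u} [CommRing A] [Algebra A R] {F G : FunctorCat.{u, v, w, t} A N} {M : SumCat N}

instance finite_aut [Finite (End M)] : Finite (Aut M) :=
  Finite.of_equiv _ (Aut.unitsEndEquivAut M).toEquiv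

theorem permRep_apply_map (g : Aut M) (f : F.obj.obj M →₀ K) (x : F.obj.obj M) :
    permRep K F M g f (F.obj.map g.hom x) = f x := by
  refine Finsupp.mapDomain_apply (Function.LeftInverse.injective (g := F.obj.map g.inv) ?_) f x
  intro y
  rw [← map_comp_apply, g.hom_inv_id, map_id_apply]

theorem permRep_single (g : Aut M) (x : F.obj.obj M) :
    permRep K F M g (Finsupp.single x 1) = Finsupp.single (F.obj.map g.hom x) 1 :=
  Finsupp.mapDomain_single

theorem map_aut_mem_iff (L : Submodule (End M) (F.obj.obj M × G.obj.obj M)) (g : Aut M)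
    (x : F.obj.obj M) (y : G.obj.obj M) :
    (F.obj.map g.hom x, G.obj.map g.hom y) ∈ L ↔ (x, y) ∈ L :=
  L.smul_mem_iff_of_isUnit (x := (x, y)) ((Aut.unitsEndEquivAut M).symm g).isUnit

variable (K) in
/-- The map of representations defined by a linear relation. -/
noncomputable def relIntertwining (L : Submodule (End M) (F.obj.obj M × G.obj.obj M)) :
    (permRep K F M).IntertwiningMap (permRep K G M) where
  toLinearMap := relMap K L
  isIntertwining' g := by
    ext x y
    obtain ⟨z, rfl⟩ : ∃ z, G.obj.map g.hom z = y :=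
      ⟨G.obj.map g.inv y, by rw [← map_comp_apply, g.inv_hom_id, map_id_apply]⟩
    classical
    simp only [LinearMap.comp_apply, Finsupp.lsingle_apply, permRep_single, permRep_apply_map,
      relMap, kernelEquiv_single, submoduleIndicator_apply, map_aut_mem_iff]

theorem relIntertwining_comp {H : FunctorCat.{u, v, w, t} A N}
    (L : Submodule (End M) (F.obj.obj M × G.obj.obj M))
    (L' : Submodule (End M) (G.obj.obj M × H.obj.obj M)) :
    (relIntertwining K L').comp (relIntertwining K L) =
      (Nat.card {y : G.obj.obj M // (0, y) ∈ L ∧ (y, 0) ∈ L'} : K) •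
        relIntertwining K (relComp L L') :=
  IntertwiningMap.ext (relMap_comp K L L')

theorem relIntertwining_eq_pushforward {L : Submodule (End M) (F.obj.obj M × G.obj.obj M)}
    {α : F ⟶ G} (hα : ∀ x y, (x, y) ∈ L ↔ α.hom.app M x = y) :
    relIntertwining K L = pushforward K α M := by
  classical
  refine IntertwiningMap.ext ((kernelEquiv_eq_iff K).2 fun x y => ?_)
  change _ = Finsupp.mapDomain _ (Finsupp.single x 1) y
  rw [Finsupp.mapDomain_single, Finsupp.single_apply, submoduleIndicator_apply]
  simp only [hα]

theorem span_range_relIntertwining [Finite (End M)] :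
    Submodule.span K (Set.range (relIntertwining (F := F) (G := G) (M := M) K)) = ⊤ := by
  refine (Submodule.eq_top_iff').2 fun T => ?_
  let f : F.obj.obj M × G.obj.obj M → K := fun p => T (Finsupp.single p.1 1) p.2
  have f_mem_span : f ∈ Submodule.span K (Set.range
      (submoduleIndicator (S := End M) (V := F.obj.obj M × G.obj.obj M) K)) := by
    refine mem_span_submoduleIndicator_of_units_smul K fun u p => ?_
    let g : Aut M := Aut.unitsEndEquivAut M u
    change T (Finsupp.single (F.obj.map g.hom p.1) 1) (G.obj.map g.hom p.2) = _
    rw [← permRep_single, T.isIntertwining, permRep_apply_map]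
  have image_f : kernelEquiv K _ _ f = T.toLinearMap := (kernelEquiv_eq_iff K).2 fun _ _ => rfl
  have T_mem_span := Submodule.mem_map_of_mem
    (f := (kernelEquiv K (F.obj.obj M) (G.obj.obj M)).toLinearMap) f_mem_span
  rw [LinearEquiv.coe_coe, image_f, Submodule.map_span, ← Set.range_comp] at T_mem_span
  have T_mem_map : T.toLinearMap ∈ (Submodule.span K (Set.range (relIntertwining K))).map
      (toLinearMapHom (permRep K F M) (permRep K G M)) := by
    rwa [Submodule.map_span, ← Set.range_comp]
  obtain ⟨T', hT', eq⟩ := T_mem_map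
  exact IntertwiningMap.toLinearMap_injective _ _ eq ▸ hT'

variable (K F M) in
/-- The homomorphism `K Aut(F) → End(K F(M))` that sends the basis vector of `α` to `α_*`. -/
noncomputable def groupAlgebraMap :
    MonoidAlgebra K (Aut F) →ₐ[K] (permRep K F M).IntertwiningMap (permRep K F M) :=
  MonoidAlgebra.lift K _ (Aut F)
    { toFun := fun α => pushforward K α.hom M
      map_one' := IntertwiningMap.ext (LinearMap.ext (pushforward_id K F M))
      map_mul' := fun α β => IntertwiningMap.ext (LinearMap.ext
        (pushforward_comp K β.hom α.hom M)) }

theorem groupAlgebraMap_single (α : Aut F) (c : K) :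
    groupAlgebraMap K F M (MonoidAlgebra.single α c) = c • pushforward K α.hom M :=
  MonoidAlgebra.lift_single _ _ _

theorem coe_Phi_apply (z : MonoidAlgebra K (Aut F)) (x : (barRep K F M).toSubmodule) :
    (Phi K F M z x : F.obj.obj M →₀ K) = groupAlgebraMap K F M z x := by
  induction z using MonoidAlgebra.induction_linear with
  | zero => rw [map_zero, map_zero]; rfl
  | add z₁ z₂ h₁ h₂ =>
    rw [map_add, map_add, IntertwiningMap.coe_add, IntertwiningMap.coe_add,
      Pi.add_apply, Pi.add_apply, Submodule.coe_add, h₁, h₂]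
  | single α c =>
    rw [groupAlgebraMap_single, Phi, MonoidAlgebra.lift_single]
    rfl

end Intertwiners

section LargestSubrepresentation

open Representation

variable {K : Type s} [Field K] {R : Type v} [Ring R] {k : ℕ} {N : Fin k → ModuleCat.{w} R}
  {A : Type u} [CommRing A] [Algebra A R] {F G : FunctorCat.{u, v, w, t} A N} {M : SumCat N}

theorem le_barRep {W : Subrepresentation (permRep K F M)} (hW : NoMapsFromBelow W) :
    W.toSubmodule ≤ (barRep K F M).toSubmodule :=
  le_iSup (fun W : {W : Subrepresentation (permRep K F M) // NoMapsFromBelow W} =>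
    W.1.toSubmodule) ⟨W, hW⟩

variable [CharZero K] [Finite (Aut M)]

theorem noMapsFromBelow_iff (W : Subrepresentation (permRep K F M)) :
    NoMapsFromBelow W ↔ ∀ G : FunctorCat.{u, v, w, t} A N, StrictlyBelow G F →
      ∀ ψ : (permRep K F M).IntertwiningMap (permRep K G M), ∀ x ∈ W.toSubmodule, ψ x = 0 := by
  constructor
  · intro hW G hG ψ x hx
    obtain ⟨φ, hφ⟩ := exists_quasiInverse (V := W.toSubmodule)
      (ρ := W.toRepresentation) (ψ.comp (subrepInclusion W))
    have h := hφ ⟨x, hx⟩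
    rw [hW G hG φ, IntertwiningMap.coe_zero, Pi.zero_apply, map_zero] at h
    exact h.symm
  · intro hW G hG φ
    obtain ⟨ψ, hψ⟩ := exists_quasiInverse (W := W.toSubmodule) φ
    obtain ⟨π, hπ⟩ := exists_intertwiningProjection W
    refine IntertwiningMap.ext (LinearMap.ext fun z => ?_)
    have h : ψ (π (φ z : F.obj.obj M →₀ K)) = 0 := hW G hG (ψ.comp π) (φ z) (φ z).2
    rw [hπ] at h
    have h' := hψ z
    rw [h, map_zero] at h'
    exact h'.symm

theorem eq_zero_of_mem_barRep (hG : StrictlyBelow G F)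
    (ψ : (permRep K F M).IntertwiningMap (permRep K G M)) {x : F.obj.obj M →₀ K}
    (hx : x ∈ (barRep K F M).toSubmodule) : ψ x = 0 := by
  have le_ker : (barRep K F M).toSubmodule ≤ LinearMap.ker ψ.toLinearMap :=
    iSup_le fun W y hy => (noMapsFromBelow_iff W.1).1 W.2 G hG ψ y hy
  exact le_ker hx

theorem isGreatest_barRep :
    IsGreatest {W : Subrepresentation (permRep K F M) | NoMapsFromBelow W} (barRep K F M) :=
  ⟨(noMapsFromBelow_iff _).2 fun _ hG ψ _ hx => eq_zero_of_mem_barRep hG ψ hx,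
    fun _ hW => le_barRep hW⟩

end LargestSubrepresentation

section BelowIdeal

open Representation

variable {K : Type s} [Field K] {R : Type v} [Ring R] {k : ℕ} {N : Fin k → ModuleCat.{w} R}
  {A : Type u} [CommRing A] [Algebra A R] {F : FunctorCat.{u, v, w, t} A N} {M : SumCat N}

/-- The endomorphism `T` of `K F(M)` factors through `K G(M)` for some `G ≺ F`. -/
def FactorsBelow (T : (permRep K F M).IntertwiningMap (permRep K F M)) : Prop :=
  ∃ G : FunctorCat.{u, v, w, t} A N, StrictlyBelow G F ∧
    ∃ (ψ : (permRep K F M).IntertwiningMap (permRep K G M))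
      (χ : (permRep K G M).IntertwiningMap (permRep K F M)), χ.comp ψ = T

variable (K F M) in
/-- The left ideal of `End(K F(M))` spanned by the endomorphisms that factor through `K G(M)` for
some `G ≺ F`. -/
noncomputable def belowIdeal : Ideal ((permRep K F M).IntertwiningMap (permRep K F M)) where
  __ := (Submodule.span K {T : (permRep K F M).IntertwiningMap (permRep K F M) |
    FactorsBelow T}).toAddSubmonoid
  smul_mem' T z hz := by
    induction hz using Submodule.span_induction with
    | mem z hz =>
      obtain ⟨G, hG, ψ, χ, rfl⟩ := hz
      exact Submodule.subset_span ⟨G, hG, ψ, T.comp χ, rfl⟩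
    | zero => rw [smul_zero]; exact Submodule.zero_mem _
    | add z₁ z₂ _ _ h₁ h₂ => rw [smul_add]; exact Submodule.add_mem _ h₁ h₂
    | smul c z _ h => rw [smul_comm]; exact Submodule.smul_mem _ c h

theorem comp_mem_belowIdeal {G : FunctorCat.{u, v, w, t} A N} (hG : StrictlyBelow G F)
    (ψ : (permRep K F M).IntertwiningMap (permRep K G M))
    (χ : (permRep K G M).IntertwiningMap (permRep K F M)) : χ.comp ψ ∈ belowIdeal K F M :=
  Submodule.subset_span ⟨G, hG, ψ, χ, rfl⟩

variable [CharZero K]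

theorem relIntertwining_mem_belowIdeal {L : Submodule (End M) (F.obj.obj M × F.obj.obj M)}
    (hL : ¬ Nonempty ((StableRelation.extend L).core ≅ F)) :
    relIntertwining K L ∈ belowIdeal K F M := by
  let H := StableRelation.extend L
  let i := appEnd H.codomain.incl M
  let p : H.codomain.sub.obj.obj M →ₗ[End M] H.core.obj.obj M := appEnd H.indeterminacy.proj M
  let L₁ := (L.comap (LinearMap.id.prodMap i)).map (LinearMap.id.prodMap p)
  let L₂ := LinearMap.range (p.prod i)
  have comp_eq : relComp L₁ L₂ = L := by
    refine relComp_eq_of_subquotient (fun x y hxy => ?_) (fun y hy => ?_)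
    · have hy : y ∈ H.codomain.obj M :=
        StableRelation.mem_codomain.2 ⟨x, StableRelation.mem_extend_self.2 hxy⟩
      exact ⟨⟨y, hy⟩, rfl⟩
    · rw [← StableRelation.mem_extend_self]
      exact (Submodule.Quotient.mk_eq_zero (H.indeterminacy.obj M)).1 hy
  have : Nonempty {y : H.core.obj.obj M // (0, y) ∈ L₁ ∧ (y, 0) ∈ L₂} :=
    ⟨⟨0, L₁.zero_mem, L₂.zero_mem⟩⟩
  have scalar_ne_zero : (Nat.card {y : H.core.obj.obj M // (0, y) ∈ L₁ ∧ (y, 0) ∈ L₂} : K) ≠ 0 :=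
    Nat.cast_ne_zero.2 Nat.card_pos.ne'
  have smul_mem := comp_mem_belowIdeal ⟨H.isSubquotient_core, hL⟩
    (relIntertwining K L₁) (relIntertwining K L₂)
  rw [relIntertwining_comp, comp_eq] at smul_mem
  exact (Submodule.smul_mem_iff ((belowIdeal K F M).restrictScalars K) scalar_ne_zero).1 smul_mem

theorem range_groupAlgebraMap_sup_belowIdeal [Finite (End M)] :
    LinearMap.range (groupAlgebraMap K F M).toLinearMap ⊔ (belowIdeal K F M).restrictScalars K =
      ⊤ := by
  rw [eq_top_iff, ← span_range_relIntertwining, Submodule.span_le]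
  rintro _ ⟨L, rfl⟩
  by_cases hL : Nonempty ((StableRelation.extend L).core ≅ F)
  · obtain ⟨α, hα⟩ := StableRelation.exists_aut_of_iso _ hL.some
    refine Submodule.mem_sup_left ⟨MonoidAlgebra.single α 1, ?_⟩
    rw [AlgHom.toLinearMap_apply, groupAlgebraMap_single, one_smul]
    exact (relIntertwining_eq_pushforward fun x y => by
      rw [← hα, StableRelation.mem_extend_self]).symm
  · exact Submodule.mem_sup_right (relIntertwining_mem_belowIdeal hL)

variable [Finite (Aut M)] in
theorem apply_eq_zero_of_mem_belowIdeal {T : (permRep K F M).IntertwiningMap (permRep K F M)}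
    (hT : T ∈ belowIdeal K F M) {x : F.obj.obj M →₀ K} (hx : x ∈ (barRep K F M).toSubmodule) :
    T x = 0 := by
  have le_ker : Submodule.span K {T : (permRep K F M).IntertwiningMap (permRep K F M) |
      FactorsBelow T} ≤ LinearMap.ker (LinearMap.applyₗ x ∘ₗ toLinearMapHom _ _) := by
    refine Submodule.span_le.2 ?_
    rintro _ ⟨G, hG, ψ, χ, rfl⟩
    change χ (ψ x) = 0
    rw [eq_zero_of_mem_barRep hG ψ hx, map_zero]
  exact le_ker hT

variable [Finite (Aut M)] in
theorem mem_belowIdeal_iff {T : (permRep K F M).IntertwiningMap (permRep K F M)} :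
    T ∈ belowIdeal K F M ↔ ∀ x ∈ (barRep K F M).toSubmodule, T x = 0 := by
  refine ⟨fun hT x hx => apply_eq_zero_of_mem_belowIdeal hT hx, fun hT => ?_⟩
  obtain ⟨e, he, right_identity⟩ := exists_right_identity_of_ideal (belowIdeal K F M)
  have ker_le : e.ker.toSubmodule ≤ (barRep K F M).toSubmodule := by
    refine le_barRep ((noMapsFromBelow_iff _).2 fun G hG ψ x hx => ?_)
    obtain ⟨χ, hχ⟩ := exists_quasiInverse ψ
    have χψ_apply : χ (ψ x) = 0 := calc
      χ (ψ x) = (χ.comp ψ * e) x := by rw [right_identity _ (comp_mem_belowIdeal hG ψ χ)]; rfl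
      _ = χ (ψ (e x)) := rfl
      _ = 0 := by rw [show e x = 0 from hx, map_zero, map_zero]
    rw [← hχ, χψ_apply, map_zero]
  suffices T_eq : T * e = T from T_eq ▸ (belowIdeal K F M).mul_mem_left T he
  refine IntertwiningMap.ext (LinearMap.ext fun x => ?_)
  have diff_mem : x - e x ∈ (barRep K F M).toSubmodule := ker_le <| by
    change e (x - e x) = 0
    rw [map_sub, sub_eq_zero]
    exact (DFunLike.congr_fun (right_identity e he) x).symm
  have T_diff := hT _ diff_mem
  rw [map_sub, sub_eq_zero] at T_diff
  exact T_diff.symm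

theorem Phi_surjective [Finite (End M)] : Function.Surjective (Phi K F M) := by
  intro T
  obtain ⟨π, hπ⟩ := exists_intertwiningProjection (barRep K F M)
  have extension_mem : (subrepInclusion (barRep K F M)).comp (T.comp π) ∈
      LinearMap.range (groupAlgebraMap K F M).toLinearMap ⊔
        (belowIdeal K F M).restrictScalars K :=
    range_groupAlgebraMap_sup_belowIdeal (K := K) (F := F) (M := M) ▸ Submodule.mem_top
  obtain ⟨_, ⟨z, rfl⟩, y, hy, sum_eq⟩ := Submodule.mem_sup.1 extension_mem
  refine ⟨z, IntertwiningMap.ext (LinearMap.ext fun x => Subtype.ext ?_)⟩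
  have eval := DFunLike.congr_fun sum_eq (x : F.obj.obj M →₀ K)
  rw [IntertwiningMap.coe_add, Pi.add_apply, apply_eq_zero_of_mem_belowIdeal hy x.2,
    add_zero] at eval
  refine (coe_Phi_apply z x).trans (eval.trans ?_)
  change (T (π x) : F.obj.obj M →₀ K) = T x
  rw [hπ]

end BelowIdeal

section MatrixUnits

/-- A complete system of matrix units in a semiring: the elements `unit i p q`, for a fixed block
`i`, multiply like elementary matrices, different blocks annihilate each other, and the diagonal
units sum to one. -/
structure MatrixUnits (S : Type*) [Semiring S] {ι : Type*} [Fintype ι] (κ : ι → Type*)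
    [∀ i, Fintype (κ i)] where
  /-- The elementary matrix of the block `i` with entry one in the row `p` and the column `q`. -/
  unit : ∀ i, κ i → κ i → S
  unit_mul_unit : ∀ i p q r, unit i p q * unit i q r = unit i p r
  unit_mul_unit_of_ne : ∀ {i i'} (p : κ i) {q : κ i} {r : κ i'} (s : κ i'),
    (⟨i, q⟩ : Σ i, κ i) ≠ ⟨i', r⟩ → unit i p q * unit i' r s = 0
  sum_unit : ∑ i, ∑ p, unit i p p = 1

namespace MatrixUnits

variable {S : Type*} [Semiring S] {ι : Type*} [Fintype ι] {κ : ι → Type*} [∀ i, Fintype (κ i)]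
  (E : MatrixUnits S κ) {V : Type*} [AddCommMonoid V] [Module S V]

/-- The part of the submodule `L` that is fixed by the diagonal matrix unit at `p`. -/
def Corner (L : Submodule S V) {i : ι} (p : κ i) : Type _ :=
  {x : V // x ∈ L ∧ E.unit i p p • x = x}

variable {E} {L : Submodule S V} {o : ∀ i, κ i}

section CornerSum

variable [∀ i, Fintype (E.Corner L (o i))]

/-- The sum of all elements of the corners at `o i`, each moved to its own position `n i x`. -/
def cornerSum (n : ∀ i, E.Corner L (o i) ↪ κ i) : V :=
  ∑ i, ∑ x : E.Corner L (o i), E.unit i (n i x) (o i) • x.1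

theorem cornerSum_mem (n : ∀ i, E.Corner L (o i) ↪ κ i) : cornerSum n ∈ L :=
  L.sum_mem fun _ _ => L.sum_mem fun x _ => L.smul_mem _ x.2.1

theorem unit_smul_cornerSum (n : ∀ i, E.Corner L (o i) ↪ κ i) (i : ι) (x : E.Corner L (o i)) :
    E.unit i (o i) (n i x) • cornerSum n = x.1 := by
  simp only [cornerSum, Finset.smul_sum, smul_smul]
  rw [Finset.sum_eq_single i, Finset.sum_eq_single x, E.unit_mul_unit]
  · exact x.2.2
  · intro y _ hy
    rw [E.unit_mul_unit_of_ne, zero_smul]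
    exact fun h => hy ((n i).injective (eq_of_heq (Sigma.mk.inj_iff.1 h).2.symm))
  · exact fun h => absurd (Finset.mem_univ x) h
  · intro i' _ hi'
    refine Finset.sum_eq_zero fun y _ => ?_
    rw [E.unit_mul_unit_of_ne, zero_smul]
    exact fun h => hi' (Sigma.mk.inj_iff.1 h).1.symm
  · exact fun h => absurd (Finset.mem_univ i) h

theorem span_cornerSum (n : ∀ i, E.Corner L (o i) ↪ κ i) : Submodule.span S {cornerSum n} = L := by
  refine le_antisymm ((Submodule.span_singleton_le_iff_mem _ _).2 (cornerSum_mem n)) fun l hl => ?_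
  rw [← one_smul S l, ← E.sum_unit]
  simp only [Finset.sum_smul]
  refine Submodule.sum_mem _ fun i _ => Submodule.sum_mem _ fun p _ => ?_
  let x : E.Corner L (o i) := ⟨E.unit i (o i) p • l, L.smul_mem _ hl, by
    rw [smul_smul, E.unit_mul_unit]⟩
  have l_eq : E.unit i p p • l = E.unit i p (o i) • E.unit i (o i) (n i x) • cornerSum n := by
    rw [unit_smul_cornerSum, smul_smul, E.unit_mul_unit]
  rw [l_eq]
  exact Submodule.smul_mem _ _ (Submodule.smul_mem _ _ (Submodule.mem_span_singleton_self _))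

end CornerSum

theorem exists_span_singleton_eq (n : ∀ i, Nonempty (E.Corner L (o i) ↪ κ i)) :
    ∃ x, Submodule.span S {x} = L := by
  have : ∀ i, Fintype (E.Corner L (o i)) := fun i => Fintype.ofInjective _ (n i).some.injective
  exact ⟨_, span_cornerSum fun i => (n i).some⟩

end MatrixUnits

end MatrixUnits

section Decomposition

variable {R : Type v} [Ring R] {k : ℕ} {N : Fin k → ModuleCat.{w} R} {X Y Z : SumCat N}
  {a b c : Fin k → ℕ}

/-- The morphism from `X` to `Y` that maps the `j`-th copy of `N i` in `X` identically to the
`j'`-th copy of `N i` in `Y`, and all other summands to zero. -/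
noncomputable def transfer (e : X.obj ≃ₗ[R] ((i : Fin k) → Fin (a i) → N i))
    (e' : Y.obj ≃ₗ[R] ((i : Fin k) → Fin (b i) → N i)) (i : Fin k) (j : Fin (a i))
    (j' : Fin (b i)) : X ⟶ Y :=
  ObjectProperty.homMk (ModuleCat.ofHom
    (e'.symm.toLinearMap ∘ₗ LinearMap.single R (fun i => Fin (b i) → N i) i ∘ₗ
      LinearMap.single R (fun _ => N i) j' ∘ₗ LinearMap.proj j ∘ₗ LinearMap.proj i ∘ₗ
        e.toLinearMap))

variable (e : X.obj ≃ₗ[R] ((i : Fin k) → Fin (a i) → N i))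
  (e' : Y.obj ≃ₗ[R] ((i : Fin k) → Fin (b i) → N i))
  (e'' : Z.obj ≃ₗ[R] ((i : Fin k) → Fin (c i) → N i))

theorem transfer_apply (i : Fin k) (j : Fin (a i)) (j' : Fin (b i)) (x : X.obj) :
    (transfer e e' i j j').hom.hom x = e'.symm (Pi.single i (Pi.single j' (e x i j))) := rfl

theorem hom_ext_apply {f g : X ⟶ Y} (h : ∀ x, f.hom.hom x = g.hom.hom x) : f = g :=
  ObjectProperty.hom_ext _ (ModuleCat.hom_ext (LinearMap.ext h))

theorem transfer_comp (i : Fin k) (j : Fin (a i)) (j' : Fin (b i)) (j'' : Fin (c i)) :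
    transfer e e' i j j' ≫ transfer e' e'' i j' j'' = transfer e e'' i j j'' := by
  refine hom_ext_apply fun x => ?_
  change (transfer e' e'' i j' j'').hom.hom ((transfer e e' i j j').hom.hom x) = _
  simp only [transfer_apply, LinearEquiv.apply_symm_apply, Pi.single_eq_same]

theorem transfer_comp_of_ne {i i₂ : Fin k} (j : Fin (a i)) {j' : Fin (b i)} {j₂ : Fin (b i₂)}
    (j₃ : Fin (c i₂)) (h : (⟨i, j'⟩ : Σ i, Fin (b i)) ≠ ⟨i₂, j₂⟩) :
    transfer e e' i j j' ≫ transfer e' e'' i₂ j₂ j₃ = 0 := by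
  refine hom_ext_apply fun x => ?_
  change (transfer e' e'' i₂ j₂ j₃).hom.hom ((transfer e e' i j j').hom.hom x) = 0
  simp only [transfer_apply, LinearEquiv.apply_symm_apply]
  by_cases hi : i = i₂
  · subst hi
    have hj : j₂ ≠ j' := fun hj => h (by rw [hj])
    simp [hj]
  · simp [Pi.single_eq_of_ne (Ne.symm hi)]

theorem sum_transfer : ∑ i, ∑ j, transfer e e i j j = 𝟙 X := by
  refine hom_ext_apply fun x => ?_
  let evaluation : (X ⟶ X) →+ X.obj :=
    { toFun := fun f => f.hom.hom x
      map_zero' := rfl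
      map_add' := fun _ _ => rfl }
  change evaluation (∑ i, ∑ j, transfer e e i j j) = x
  simp only [map_sum]
  change ∑ i, ∑ j, e.symm (Pi.single i (Pi.single j (e x i j))) = x
  have sum_copies : ∀ i, ∑ j, (Pi.single i (Pi.single j (e x i j)) :
      (i : Fin k) → Fin (a i) → N i) = Pi.single i (e x i) := fun i =>
    (map_sum (AddMonoidHom.single (fun i => Fin (a i) → N i) i) _ _).symm.trans
      (congrArg (Pi.single i) (Finset.univ_sum_single (e x i)))
  simp only [← map_sum, sum_copies, Finset.univ_sum_single, LinearEquiv.symm_apply_apply]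

/-- The endomorphisms of a direct sum that transfer one copy of a summand to another. -/
noncomputable def transferUnits : MatrixUnits (End X) (fun i => Fin (a i)) where
  unit i p q := transfer e e i q p
  unit_mul_unit i p q r := transfer_comp e e e i r q p
  unit_mul_unit_of_ne p _ _ s h := transfer_comp_of_ne e e e s p h.symm
  sum_unit := sum_transfer e

end Decomposition

section LargeMultiplicities

variable {R : Type v} [Ring R] {k : ℕ} {N : Fin k → ModuleCat.{w} R}
  {A : Type u} [CommRing A] [Algebra A R] {F G : FunctorCat.{u, v, w, t} A N} {M : SumCat N}
  {a : Fin k → ℕ}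

theorem exists_sum_comp_eq_id (hM : HasMultiplicities N M.obj a) (ha : ∀ i, 0 < a i)
    (X : SumCat N) : ∃ (ι : Type) (_ : Fintype ι) (f : ι → (X ⟶ M)) (g : ι → (M ⟶ X)),
      ∑ i, f i ≫ g i = 𝟙 X := by
  obtain ⟨e⟩ := hM
  obtain ⟨b, ⟨e'⟩⟩ := X.property
  refine ⟨Σ i, Fin (b i), inferInstance, fun p => transfer e' e p.1 p.2 ⟨0, ha p.1⟩,
    fun p => transfer e e' p.1 ⟨0, ha p.1⟩ p.2, ?_⟩
  simp only [transfer_comp]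
  rw [Fintype.sum_sigma]
  exact sum_transfer e'

theorem app_injective (hM : HasMultiplicities N M.obj a) (ha : ∀ i, 0 < a i) {α : F ⟶ G}
    (h : Function.Injective (α.hom.app M)) (X : SumCat N) :
    Function.Injective (α.hom.app X) := by
  obtain ⟨ι, _, f, g, hfg⟩ := exists_sum_comp_eq_id hM ha X
  intro x y hxy
  rw [← map_id_apply x, ← map_id_apply y, ← hfg, map_sum_apply, map_sum_apply]
  refine Finset.sum_congr rfl fun i _ => ?_
  rw [map_comp_apply, map_comp_apply]
  congr 1
  refine h ?_
  rw [app_map_apply, app_map_apply, hxy]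

theorem app_surjective (hM : HasMultiplicities N M.obj a) (ha : ∀ i, 0 < a i) {α : F ⟶ G}
    (h : Function.Surjective (α.hom.app M)) (X : SumCat N) :
    Function.Surjective (α.hom.app X) := by
  obtain ⟨ι, _, f, g, hfg⟩ := exists_sum_comp_eq_id hM ha X
  intro y
  choose z hz using fun i => h (G.obj.map (f i) y)
  refine ⟨∑ i, F.obj.map (g i) (z i), ?_⟩
  calc α.hom.app X (∑ i, F.obj.map (g i) (z i))
      = ∑ i, α.hom.app X (F.obj.map (g i) (z i)) := map_sum (α.hom.app X).hom _ _
    _ = ∑ i, G.obj.map (f i ≫ g i) y :=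
        Finset.sum_congr rfl fun i _ => by rw [app_map_apply, hz, map_comp_apply]
    _ = y := by rw [← map_sum_apply, hfg, map_id_apply]

theorem hom_ext_of_app_eq (hM : HasMultiplicities N M.obj a) (ha : ∀ i, 0 < a i) {α β : F ⟶ G}
    (h : ∀ x, α.hom.app M x = β.hom.app M x) : α = β := by
  refine ObjectProperty.hom_ext _ (NatTrans.ext (funext fun X => ModuleCat.hom_ext
    (LinearMap.ext fun x => ?_)))
  obtain ⟨ι, _, f, g, hfg⟩ := exists_sum_comp_eq_id hM ha X
  change α.hom.app X x = β.hom.app X x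
  rw [← map_id_apply (α.hom.app X x), ← map_id_apply (β.hom.app X x), ← hfg, map_sum_apply,
    map_sum_apply]
  refine Finset.sum_congr rfl fun i _ => ?_
  rw [map_comp_apply, map_comp_apply, ← app_map_apply α (f i), ← app_map_apply β (f i), h]

variable (N) in
/-- The direct sum of the modules `N i`. -/
noncomputable def sumObj : SumCat N where
  obj := ModuleCat.of R ((i : Fin k) → Fin 1 → N i)
  property := ⟨fun _ => 1, ⟨LinearEquiv.refl R _⟩⟩

theorem card_corner_le (e : M.obj ≃ₗ[R] ((i : Fin k) → Fin (a i) → N i))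
    (L : Submodule (End M) (F.obj.obj M × G.obj.obj M)) {i : Fin k} (p : Fin (a i)) :
    Nat.card ((transferUnits e).Corner L p) ≤
      Nat.card (F.obj.obj (sumObj N) × G.obj.obj (sumObj N)) := by
  let e₀ : (sumObj N).obj ≃ₗ[R] ((i : Fin k) → Fin 1 → N i) := LinearEquiv.refl R _
  let f : M ⟶ sumObj N := transfer (b := fun _ => 1) e e₀ i p 0
  let g : sumObj N ⟶ M := transfer (a := fun _ => 1) e₀ e i 0 p
  have unit_eq : (transferUnits e).unit i p p = f ≫ g :=
    (transfer_comp (b := fun _ => 1) e e₀ e i p 0 p).symm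
  refine Nat.card_le_card_of_injective
    (fun x => (F.obj.map f x.1.1, G.obj.map f x.1.2)) ?_
  have leftInverse : ∀ x : (transferUnits e).Corner L p,
      (F.obj.map g (F.obj.map f x.1.1), G.obj.map g (G.obj.map f x.1.2)) = x.1 := fun x => by
    rw [← map_comp_apply, ← map_comp_apply, ← unit_eq]
    exact x.2.2
  intro x y hxy
  refine Subtype.ext ?_
  rw [← leftInverse x, ← leftInverse y]
  exact congrArg (Prod.map (F.obj.map g) (G.obj.map g)) hxy

theorem exists_span_singleton_eq (hM : HasMultiplicities N M.obj a)
    (ha : ∀ i, Nat.card (F.obj.obj (sumObj N) × G.obj.obj (sumObj N)) ≤ a i)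
    (L : Submodule (End M) (F.obj.obj M × G.obj.obj M)) :
    ∃ x, Submodule.span (End M) {x} = L := by
  obtain ⟨e⟩ := hM
  have a_pos : ∀ i, 0 < a i := fun i => Nat.card_pos.trans_le (ha i)
  refine (transferUnits e).exists_span_singleton_eq (o := fun i => ⟨0, a_pos i⟩) fun i => ?_
  have : Finite ((transferUnits e).Corner L (⟨0, a_pos i⟩ : Fin (a i))) :=
    inferInstanceAs (Finite {x : F.obj.obj M × G.obj.obj M // _})
  have := Fintype.ofFinite ((transferUnits e).Corner L (⟨0, a_pos i⟩ : Fin (a i)))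
  refine Function.Embedding.nonempty_of_card_le ?_
  rw [Fintype.card_fin, ← Nat.card_eq_fintype_card]
  exact (card_corner_le e L _).trans (ha i)

end LargeMultiplicities

section Independence

open Representation

variable {K : Type s} [Field K] {R : Type v} [Ring R] {k : ℕ} {N : Fin k → ModuleCat.{w} R}
  {A : Type u} [CommRing A] [Algebra A R] {F G : FunctorCat.{u, v, w, t} A N} {M : SumCat N}
  {a : Fin k → ℕ}

theorem linearIndependent_relIntertwining
    (h : ∀ L : Submodule (End M) (F.obj.obj M × G.obj.obj M),
      ∃ x, Submodule.span (End M) {x} = L) :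
    LinearIndependent K
      (relIntertwining K : Submodule (End M) (F.obj.obj M × G.obj.obj M) → _) :=
  LinearIndependent.of_comp (toLinearMapHom _ _) (linearIndependent_relMap K h)

variable (M) in
/-- The graph of a component of a natural transformation, as a linear relation. -/
noncomputable def graphRel (α : F ⟶ G) : Submodule (End M) (F.obj.obj M × G.obj.obj M) :=
  LinearMap.graph (appEnd α M)

theorem mem_graphRel {α : F ⟶ G} {x : F.obj.obj M} {y : G.obj.obj M} :
    (x, y) ∈ graphRel M α ↔ α.hom.app M x = y := eq_comm

theorem graphRel_injective (hM : HasMultiplicities N M.obj a) (ha : ∀ i, 0 < a i) :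
    Function.Injective (graphRel M : (F ⟶ G) → _) := fun _ _ h =>
  hom_ext_of_app_eq hM ha fun _ => (mem_graphRel.1 (h ▸ mem_graphRel.2 rfl)).symm

theorem groupAlgebraMap_eq_linearCombination (z : MonoidAlgebra K (Aut F)) :
    groupAlgebraMap K F M z =
      Finsupp.linearCombination K (fun α => relIntertwining K (graphRel M α.hom)) z.coeff := by
  induction z using MonoidAlgebra.induction_linear with
  | zero => rw [map_zero, MonoidAlgebra.coeff_zero, map_zero]
  | add z₁ z₂ h₁ h₂ => rw [map_add, MonoidAlgebra.coeff_add, map_add, h₁, h₂]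
  | single α c =>
    rw [groupAlgebraMap_single, MonoidAlgebra.coeff_single, Finsupp.linearCombination_single,
      relIntertwining_eq_pushforward fun _ _ => mem_graphRel]

variable (F M) in
/-- The linear relations on `F(M)` that are not graphs of automorphisms of `F`. -/
def nonGraphs : Set (Submodule (End M) (F.obj.obj M × F.obj.obj M)) :=
  (Set.range fun α : Aut F => graphRel M α.hom)ᶜ

theorem card_le_of_relComp_eq_graphRel {H : FunctorCat.{u, v, w, t} A N} {α : F ⟶ H}
    (hα : Function.Injective (α.hom.app M))
    {L : Submodule (End M) (F.obj.obj M × G.obj.obj M)}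
    {L' : Submodule (End M) (G.obj.obj M × H.obj.obj M)} (h : relComp L L' = graphRel M α) :
    Nat.card (F.obj.obj M) ≤ Nat.card (G.obj.obj M) := by
  have mem_iff : ∀ x z, (∃ y, (x, y) ∈ L ∧ (y, z) ∈ L') ↔ α.hom.app M x = z := fun x z =>
    (h ▸ mem_relComp (p := (x, z))).symm.trans mem_graphRel
  choose s left_mem right_mem using fun x => (mem_iff x _).2 rfl
  refine Nat.card_le_card_of_injective s fun x x' hxx' => hα ?_
  exact (mem_iff _ _).1 ⟨s x, left_mem x, hxx' ▸ right_mem x'⟩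

theorem nonempty_iso_of_isSubquotient (hM : HasMultiplicities N M.obj a) (ha : ∀ i, 0 < a i)
    (hGF : IsSubquotient G F) (h : Nat.card (F.obj.obj M) ≤ Nat.card (G.obj.obj M)) :
    Nonempty (G ≅ F) := by
  obtain ⟨H, i, p, hi, hp⟩ := hGF
  obtain ⟨hiM, hpM⟩ := bijective_of_card_le (hi M) (hp M) h
  let ei : H ≅ F := isoOfBijective i fun X => ⟨hi X, app_surjective hM ha hiM.2 X⟩
  let ep : H ≅ G := isoOfBijective p fun X => ⟨app_injective hM ha hpM.1 X, hp X⟩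
  exact ⟨ep.symm ≪≫ ei⟩

theorem relComp_mem_nonGraphs (hM : HasMultiplicities N M.obj a) (ha : ∀ i, 0 < a i)
    (hG : StrictlyBelow G F) (L : Submodule (End M) (F.obj.obj M × G.obj.obj M))
    (L' : Submodule (End M) (G.obj.obj M × F.obj.obj M)) : relComp L L' ∈ nonGraphs F M := by
  rintro ⟨α, hα⟩
  have α_injective : Function.Injective (α.hom.hom.app M) :=
    Function.LeftInverse.injective (g := α.inv.hom.app M) fun x =>
      congrArg (fun β : F ⟶ F => β.hom.app M x) α.hom_inv_id
  exact hG.2 (nonempty_iso_of_isSubquotient hM ha hG.1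
    (card_le_of_relComp_eq_graphRel α_injective hα.symm))

theorem comp_mem_span_nonGraphs [Finite (End M)] (hM : HasMultiplicities N M.obj a)
    (ha : ∀ i, 0 < a i) (hG : StrictlyBelow G F)
    (ψ : (permRep K F M).IntertwiningMap (permRep K G M))
    (χ : (permRep K G M).IntertwiningMap (permRep K F M)) :
    χ.comp ψ ∈ Submodule.span K (relIntertwining K '' nonGraphs F M) := by
  have comp_mem := Submodule.apply_mem_map₂
    (IntertwiningMap.llcomp (permRep K F M) (permRep K G M) (permRep K F M))
    (Submodule.mem_top (x := χ)) (Submodule.mem_top (x := ψ))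
  rw [← span_range_relIntertwining, ← span_range_relIntertwining,
    Submodule.map₂_span_span] at comp_mem
  refine Submodule.span_le.2 ?_ comp_mem
  rintro _ ⟨_, ⟨L', rfl⟩, _, ⟨L, rfl⟩, rfl⟩
  change (relIntertwining K L').comp (relIntertwining K L) ∈ _
  rw [relIntertwining_comp]
  exact Submodule.smul_mem _ _ (Submodule.subset_span
    (Set.mem_image_of_mem _ (relComp_mem_nonGraphs hM ha hG L L')))

theorem belowIdeal_le_span_nonGraphs [Finite (End M)] (hM : HasMultiplicities N M.obj a)
    (ha : ∀ i, 0 < a i) : (belowIdeal K F M).restrictScalars K ≤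
      Submodule.span K (relIntertwining K '' nonGraphs F M) := by
  refine Submodule.span_le.2 ?_
  rintro _ ⟨G, hG, ψ, χ, rfl⟩
  exact comp_mem_span_nonGraphs hM ha hG ψ χ

theorem groupAlgebraMap_mem_span_graphs (z : MonoidAlgebra K (Aut F)) :
    groupAlgebraMap K F M z ∈ Submodule.span K
      (relIntertwining K '' Set.range fun α : Aut F => graphRel M α.hom) := by
  rw [← Set.range_comp, groupAlgebraMap_eq_linearCombination]
  exact Finsupp.mem_span_range_iff_exists_finsupp.2 ⟨z.coeff, rfl⟩

theorem groupAlgebraMap_injective (hM : HasMultiplicities N M.obj a) (ha : ∀ i, 0 < a i)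
    (indep : LinearIndependent K
      (relIntertwining K : Submodule (End M) (F.obj.obj M × F.obj.obj M) → _)) :
    Function.Injective (groupAlgebraMap K F M) := by
  have graph_injective : Function.Injective fun α : Aut F => graphRel M α.hom := fun _ _ h =>
    Iso.ext (graphRel_injective hM ha h)
  have indep_graphs := linearIndependent_iff_injective_finsuppLinearCombination.1
    (indep.comp _ graph_injective)
  intro z z' hz
  rw [groupAlgebraMap_eq_linearCombination, groupAlgebraMap_eq_linearCombination] at hz
  exact MonoidAlgebra.coeff_injective (indep_graphs hz)

theorem eq_zero_of_groupAlgebraMap_mem_belowIdeal [Finite (End M)]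
    (hM : HasMultiplicities N M.obj a)
    (ha : ∀ i, Nat.card (F.obj.obj (sumObj N) × F.obj.obj (sumObj N)) ≤ a i)
    {z : MonoidAlgebra K (Aut F)} (hz : groupAlgebraMap K F M z ∈ belowIdeal K F M) : z = 0 := by
  have a_pos : ∀ i, 0 < a i := fun i => Nat.card_pos.trans_le (ha i)
  have indep := linearIndependent_relIntertwining (K := K) (exists_span_singleton_eq hM ha)
  refine (injective_iff_map_eq_zero _).1 (groupAlgebraMap_injective hM a_pos indep) z ?_
  exact Submodule.disjoint_def.1 (indep.disjoint_span_image disjoint_compl_right) _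
    (groupAlgebraMap_mem_span_graphs z) (belowIdeal_le_span_nonGraphs hM a_pos hz)

theorem Phi_injective [CharZero K] [Finite (End M)] (hM : HasMultiplicities N M.obj a)
    (ha : ∀ i, Nat.card (F.obj.obj (sumObj N) × F.obj.obj (sumObj N)) ≤ a i) :
    Function.Injective (Phi K F M) := by
  refine (injective_iff_map_eq_zero (Phi K F M)).2 fun z hz => ?_
  refine eq_zero_of_groupAlgebraMap_mem_belowIdeal hM ha (mem_belowIdeal_iff.2 fun x hx => ?_)
  rw [← coe_Phi_apply z ⟨x, hx⟩, hz]
  rfl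

end Independence

section Finiteness

variable {R : Type v} [Ring R] {k : ℕ} {N : Fin k → ModuleCat.{w} R}

theorem finite_end (hfin : ∀ i j, Finite (N i →ₗ[R] N j)) (M : SumCat N) : Finite (End M) := by
  obtain ⟨a, ⟨e⟩⟩ := M.property
  let component (f : M.obj →ₗ[R] M.obj) : ∀ i, Fin (a i) → ∀ j, Fin (a j) → N i →ₗ[R] N j :=
    fun i p j q => LinearMap.proj q ∘ₗ LinearMap.proj j ∘ₗ e.toLinearMap ∘ₗ f ∘ₗ
      e.symm.toLinearMap ∘ₗ LinearMap.single R (fun i => Fin (a i) → N i) i ∘ₗ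
        LinearMap.single R (fun _ => N i) p
  have component_injective : Function.Injective component := fun f g h => by
    have conj_eq : e.toLinearMap ∘ₗ f ∘ₗ e.symm.toLinearMap =
        e.toLinearMap ∘ₗ g ∘ₗ e.symm.toLinearMap :=
      LinearMap.pi_ext' fun i => LinearMap.pi_ext' fun p => LinearMap.ext fun x =>
        funext fun j => funext fun q => LinearMap.congr_fun (congr_fun₂ (congr_fun₂ h i p) j q) x
    refine LinearMap.ext fun x => e.injective ?_
    simpa using DFunLike.congr_fun conj_eq (e x)
  exact Finite.of_injective (fun f : M ⟶ M => component f.hom.hom) fun f g h =>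
    hom_ext_apply (DFunLike.congr_fun (component_injective h))

end Finiteness

end FunctorMorphing

open FunctorMorphing in
theorem theoremB_general
    {A : Type u} [CommRing A] {R : Type v} [Ring R] [Algebra A R]
    {k : ℕ} (N : Fin k → ModuleCat.{w} R) (hfin : ∀ i j, Finite (N i →ₗ[R] N j))
    (K : Type s) [Field K] [CharZero K] (F : FunctorCat.{u, v, w, t} A N) :
    (∀ M : SumCat N,
      IsGreatest {W : Subrepresentation (permRep K F M) | NoMapsFromBelow W} (barRep K F M) ∧
      Function.Surjective (Phi K F M)) ∧
    ∃ c : ℕ, ∀ (M : SumCat N) (a : Fin k → ℕ), HasMultiplicities N M.obj a →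
      (∀ i, c ≤ a i) → Function.Injective (Phi K F M) := by
  have := finite_end hfin
  exact ⟨fun _ => ⟨isGreatest_barRep, Phi_surjective⟩,
    Nat.card (F.obj.obj (sumObj N) × F.obj.obj (sumObj N)), fun _ _ hM ha => Phi_injective hM ha⟩

open FunctorMorphing IsLocalRing in
theorem theoremB
    {𝒪 : Type u} [CommRing 𝒪] [IsDomain 𝒪] [IsDiscreteValuationRing 𝒪]
    [IsAdicComplete (maximalIdeal 𝒪) 𝒪] [Finite (ResidueField 𝒪)] (ℓ : ℕ)
    {R : Type v} [Ring R] [Algebra (𝒪 ⧸ maximalIdeal 𝒪 ^ ℓ) R] [Finite R]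
    {k : ℕ} (N : Fin k → ModuleCat.{w} R) (hfin : ∀ i, Finite (N i))
    (hind : ∀ i, Indecomposable (N i))
    (K : Type s) [Field K] [IsAlgClosed K] [CharZero K]
    (F : FunctorCat.{u, v, w, t} (𝒪 ⧸ maximalIdeal 𝒪 ^ ℓ) N) :
    (∀ M : SumCat N,
      IsGreatest {W : Subrepresentation (permRep K F M) | NoMapsFromBelow W} (barRep K F M) ∧
      Function.Surjective (Phi K F M)) ∧
    ∃ c : ℕ, ∀ (M : SumCat N) (a : Fin k → ℕ), HasMultiplicities N M.obj a →
      (∀ i, c ≤ a i) → Function.Injective (Phi K F M) :=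
  theoremB_general N (fun i j => have := hfin i; have := hfin j; DFunLike.finite _) K F
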